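/- All graphs are finite and may have parallel edges and loops. For a set $S$ of vertices of a graph $G$, an *$S$-tree* is a subgraph of $G$ that is a tree and contains at least one vertex of $S$. Consider the problem *Maximum Weight $S$-Tree Packing*: **Input:** a graph $G$, a nonempty subset $S$ of $V(G)$, and a weight function $w : E(G) \to \mathbb{Q}$. **Problem:** find vertex-disjoint $S$-trees $T_1, \dots, T_m$ in $G$, for some $m$, such that $\bigcup_{i=1}^m V(T_i) = V(G)$ and $\sum_{i=1}^m \sum_{e \in E(T_i)} w(e)$ is maximum among all such families, or report that no such family exists. **Corollary.** Maximum Weight $S$-Tree Packing is solvable in polynomial time. That is, there are a single random access machine program and a polynomial $p$ such that on every instance $(G, S, w)$ (with the numerators and denominators of the weights written in binary) the program halts with a correct output after a running time, measured by logarithmic cost (the number of bits of all operands and addresses handled), of at most $p(N)$, where $N$ is the bit length of the encoded instance. -/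

import Mathlib

/-! ### Random access machines with logarithmic cost

A program works on a memory that consists of arrays of natural numbers, indexed by natural numbers.
A program mentions finitely many arrays. Every operation is charged the number of bits of all
operands and of all addresses that it handles. -/

namespace RAM

/-- A memory: `σ a i` is the content of cell `i` of the array number `a`. -/
abbrev Mem : Type := ℕ → ℕ → ℕ

/-- Arithmetic expressions; `get a i` reads the cell whose address is the value of `i`. -/
inductive Expr : Type
  | lit (n : ℕ) : Expr
  | get (a : ℕ) (i : Expr) : Expr
  | add (e f : Expr) : Expr
  | sub (e f : Expr) : Expr
  | mul (e f : Expr) : Expr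

/-- The value of an expression; the subtraction is the truncated one. -/
def Expr.eval (σ : Mem) : Expr → ℕ
  | .lit n => n
  | .get a i => σ a (i.eval σ)
  | .add e f => e.eval σ + f.eval σ
  | .sub e f => e.eval σ - f.eval σ
  | .mul e f => e.eval σ * f.eval σ

/-- The logarithmic cost of the evaluation of an expression (`Nat.size` is the bit length). -/
def Expr.cost (σ : Mem) : Expr → ℕ
  | .lit n => Nat.size n + 1
  | .get a i => i.cost σ + Nat.size (i.eval σ) + Nat.size (σ a (i.eval σ)) + 1
  | .add e f => e.cost σ + f.cost σ + Nat.size (e.eval σ) + Nat.size (f.eval σ) + 1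
  | .sub e f => e.cost σ + f.cost σ + Nat.size (e.eval σ) + Nat.size (f.eval σ) + 1
  | .mul e f => e.cost σ + f.cost σ + Nat.size (e.eval σ) + Nat.size (f.eval σ) + 1

/-- Programs: `store a i e` is the assignment `a[i] := e`, `branch e c d` is
`if e ≠ 0 then c else d`, and `loop e c` is `while e ≠ 0 do c`. -/
inductive Prog : Type
  | skip : Prog
  | store (a : ℕ) (i e : Expr) : Prog
  | seq (c d : Prog) : Prog
  | branch (e : Expr) (c d : Prog) : Prog
  | loop (e : Expr) (c : Prog) : Prog

/-- The memory `σ` after the value `v` has been written to cell `i` of array `a`. -/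
def Mem.write (σ : Mem) (a i v : ℕ) : Mem :=
  Function.update σ a (Function.update (σ a) i v)

/-- `Exec c σ τ t`: started in memory `σ`, the program `c` halts in memory `τ`, and the total
logarithmic cost of this run is `t`. A run that does not halt has no derivation. -/
inductive Exec : Prog → Mem → Mem → ℕ → Prop
  | skip (σ : Mem) : Exec .skip σ σ 1
  | store (σ : Mem) (a : ℕ) (i e : Expr) :
      Exec (.store a i e) σ (σ.write a (i.eval σ) (e.eval σ))
        (i.cost σ + e.cost σ + Nat.size (i.eval σ) + Nat.size (e.eval σ) + 1)
  | seq {c d : Prog} {σ τ ρ : Mem} {s t : ℕ} (hc : Exec c σ τ s) (hd : Exec d τ ρ t) :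
      Exec (.seq c d) σ ρ (s + t + 1)
  | branch_true {e : Expr} {c d : Prog} {σ τ : Mem} {t : ℕ} (he : e.eval σ ≠ 0)
      (hc : Exec c σ τ t) : Exec (.branch e c d) σ τ (e.cost σ + t + 1)
  | branch_false {e : Expr} {c d : Prog} {σ τ : Mem} {t : ℕ} (he : e.eval σ = 0)
      (hd : Exec d σ τ t) : Exec (.branch e c d) σ τ (e.cost σ + t + 1)
  | loop_done {e : Expr} {c : Prog} {σ : Mem} (he : e.eval σ = 0) :
      Exec (.loop e c) σ σ (e.cost σ + 1)
  | loop_step {e : Expr} {c : Prog} {σ τ ρ : Mem} {s t : ℕ} (he : e.eval σ ≠ 0)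
      (hc : Exec c σ τ s) (hl : Exec (.loop e c) τ ρ t) :
      Exec (.loop e c) σ ρ (e.cost σ + s + t + 1)

/-- The initial memory on the input `l`: array `0` holds the length of `l` followed by the entries
of `l`; every other cell is `0`. -/
def input (l : List ℕ) : Mem := fun a i => if a = 0 then (l.length :: l).getD i 0 else 0

/-- The output list: cell `0` of array `1` holds its length, the next cells hold its entries. -/
def output (σ : Mem) : List ℕ := (List.range (σ 1 0)).map fun i => σ 1 (i + 1)

/-- The number of bits that are needed to write down a list of natural numbers in binary
(with one extra symbol per entry). -/
def bitSize (l : List ℕ) : ℕ := (l.map fun x => Nat.size x + 1).sum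

/-- The search problem with instances `α`, encoded as lists of natural numbers by `enc`, and
with `IsSolution x out` saying that `out` is a correct output on the instance `x`, is solvable in
polynomial time: a single program halts on every instance with a correct output, at a total cost
that is bounded by a fixed polynomial in the bit size of the encoded instance. -/
def SolvableInPolyTime {α : Type} (enc : α → List ℕ) (IsSolution : α → List ℕ → Prop) : Prop :=
  ∃ (c : Prog) (p : Polynomial ℕ), ∀ x : α, ∃ (τ : Mem) (t : ℕ),
    Exec c (input (enc x)) τ t ∧ t ≤ p.eval (bitSize (enc x)) ∧ IsSolution x (output τ)

end RAM

/-! ### Trees and `S`-tree packings in multigraphs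

Mathlib's `Graph α β` allows parallel edges and loops, and `H ≤ G` says that `H` is a subgraph
of `G`. -/

namespace Graph

variable {α β : Type*}

/-- A graph is connected if it has a vertex and any two of its vertices are joined by a walk. -/
def IsConn (G : Graph α β) : Prop :=
  V(G).Nonempty ∧ ∀ x ∈ V(G), ∀ y ∈ V(G), Relation.ReflTransGen G.Adj x y

/-- A cycle of length `k + 1`: distinct vertices `x 0, …, x k` and distinct edges `e 0, …, e k`,
where `e i` joins `x i` to `x (i + 1)` and the indices are cyclic (so that a loop is a cycle of
length one, and two parallel edges form a cycle of length two). -/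
def IsCyc (G : Graph α β) {k : ℕ} (x : Fin (k + 1) → α) (e : Fin (k + 1) → β) : Prop :=
  Function.Injective x ∧ Function.Injective e ∧ ∀ i, G.IsLink (e i) (x i) (x (i + 1))

/-- A tree is a connected graph without cycles. -/
def IsTree (G : Graph α β) : Prop :=
  G.IsConn ∧ ∀ (k : ℕ) (x : Fin (k + 1) → α) (e : Fin (k + 1) → β), ¬ G.IsCyc x e

/-- `T 0, …, T (k - 1)` are vertex-disjoint trees in `G`, each of which contains a vertex of `S`,
and together they cover all vertices of `G`. -/
structure IsSTreePacking (G : Graph α β) (S : Set α) {k : ℕ} (T : Fin k → Graph α β) : Prop where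
  le : ∀ i, T i ≤ G
  isTree : ∀ i, (T i).IsTree
  meets : ∀ i, (V(T i) ∩ S).Nonempty
  disjoint : ∀ i j, i ≠ j → Disjoint V(T i) V(T j)
  spanning : ⋃ i, V(T i) = V(G)

open Classical in
/-- The sum of the weights of all edges of all members of a family of graphs. -/
noncomputable def packingWeight [Fintype β] (w : β → ℚ) {k : ℕ} (T : Fin k → Graph α β) : ℚ :=
  ∑ i, ∑ e with e ∈ E(T i), w e

/-- An `S`-tree packing of maximum weight. -/
def IsMaxSTreePacking [Fintype β] (G : Graph α β) (S : Set α) (w : β → ℚ) {k : ℕ}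
    (T : Fin k → Graph α β) : Prop :=
  G.IsSTreePacking S T ∧
    ∀ (l : ℕ) (U : Fin l → Graph α β), G.IsSTreePacking S U → packingWeight w U ≤ packingWeight w T

end Graph

/-! ### The computational problem -/

/-- An instance of the problem: a finite multigraph with vertices `0, …, n - 1` and edges
`0, …, m - 1`, a nonempty set of vertices, and rational edge weights. -/
structure STreeInstance : Type where
  n : ℕ
  m : ℕ
  /-- the two ends of an edge (their order is irrelevant) -/
  ends : Fin m → Fin n × Fin n
  S : Finset (Fin n)
  S_nonempty : S.Nonempty
  w : Fin m → ℚ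

namespace STreeInstance

/-- The graph of an instance. -/
def graph (I : STreeInstance) : Graph (Fin I.n) (Fin I.m) where
  vertexSet := Set.univ
  IsLink e x y := s((I.ends e).1, (I.ends e).2) = s(x, y)
  isLink_symm := fun _ _ => ⟨fun _ _ h => h.trans Sym2.eq_swap⟩
  eq_or_eq_of_isLink_of_isLink := by
    intro e x y v w h h'
    have h2 := h.symm.trans h'
    rw [Sym2.eq_iff] at h2
    tauto
  left_mem_of_isLink := fun _ _ _ _ => Set.mem_univ _

/-- The input list: `n` and `m`; for each vertex, `1` if it is in `S` and `0` otherwise; for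
each edge, its two ends and its weight, as a sign (`1` for a negative weight, `0` otherwise), the
absolute value of the numerator, and the denominator, in lowest terms. -/
def encode (I : STreeInstance) : List ℕ :=
  [I.n, I.m] ++ (List.finRange I.n).map (fun v => if v ∈ I.S then 1 else 0) ++
    (List.finRange I.m).flatMap fun e =>
      [((I.ends e).1 : ℕ), ((I.ends e).2 : ℕ), if I.w e < 0 then 1 else 0,
        (I.w e).num.natAbs, (I.w e).den]

/-- `f` describes the disjoint sets `A 0, …, A (k - 1)`: it maps the elements of `A i` to `i + 1`
and the elements that are in none of the sets to `0`. -/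
def IsLabelling {γ : Type} {k : ℕ} (A : Fin k → Set γ) (f : γ → ℕ) : Prop :=
  ∀ x, (∀ i, x ∈ A i → f x = i + 1) ∧ ((∀ i, x ∉ A i) → f x = 0)

/-- The list `out` describes the family `T 0, …, T (k - 1)`: it consists of `k`, the label of each
vertex, and the label of each edge. -/
def Describes (I : STreeInstance) {k : ℕ} (T : Fin k → Graph (Fin I.n) (Fin I.m))
    (out : List ℕ) : Prop :=
  ∃ (f : Fin I.n → ℕ) (g : Fin I.m → ℕ),
    IsLabelling (fun i => (T i).vertexSet) f ∧ IsLabelling (fun i => (T i).edgeSet) g ∧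
      out = k :: ((List.finRange I.n).map f ++ (List.finRange I.m).map g)

/-- The correct outputs: `1` followed by the description of an `S`-tree packing of maximum weight
or, if there is no `S`-tree packing at all, the single number `0`. -/
def IsSolution (I : STreeInstance) (out : List ℕ) : Prop :=
  (∃ (k : ℕ) (T : Fin k → Graph (Fin I.n) (Fin I.m)) (l : List ℕ),
      I.graph.IsMaxSTreePacking (I.S : Set (Fin I.n)) I.w T ∧ I.Describes T l ∧ out = 1 :: l) ∨
    ((¬ ∃ (k : ℕ) (T : Fin k → Graph (Fin I.n) (Fin I.m)),
      I.graph.IsSTreePacking (I.S : Set (Fin I.n)) T) ∧ out = [0])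

end STreeInstance

/-! Add to the graph a vertex `none` joined to every vertex of `S` by an edge of weight 0. Deleting
`none` from a spanning tree of this `rooted` graph leaves an `S`-tree packing of the same weight.
Conversely, a packing becomes a spanning tree once every tree is attached to `none` at one of its
vertices in `S`. The problem is thus that of a maximum weight spanning tree, and Prim's algorithm
from `none` solves it: always add the heaviest edge that leaves the vertices reached so far. If no
such edge exists before all vertices are reached, there is no packing.

Optimality rests on the exchange step `exists_exchange`, which preserves the invariant `IsGreedy`.
`IsSTreePacking.exists_joined` turns a rival packing into a connected spanning edge set that has few
enough edges for `IsGreedy.sum_le` to apply. `Grown` describes the algorithm by labels on the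
original graph, and `Grown.isMaxSTreePacking` combines these facts.

For the running time, the algorithm is written in a language `Code` whose loops run as often as one
of the first two input entries says, and which never stores a product. Bit lengths then grow only by
a polynomial amount, and `Code.WF.exec` bounds the cost. Rational weights are compared by
cross-multiplication inside a test. By `run_round`, a round is a step of `Grown` unless nothing is
left to add, so `n` rounds suffice.

Arrays of the program: 0 is the input, 1 the state in the layout of the output, 2 and 3 are loop
counters, 4 says whether a candidate exists, 5 to 10 hold the best candidate (vertex, edge, label,
sign, numerator, denominator), 11 to 16 the current one, and 17 flags an unlabelled vertex. -/

/-! ### Bit lengths of values and costs of expressions -/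

theorem Nat.size_add_le (a b : ℕ) : Nat.size (a + b) ≤ max (Nat.size a) (Nat.size b) + 1 := by
  rw [Nat.size_le, pow_succ]
  have ha := (Nat.lt_size_self a).trans_le
    (Nat.pow_le_pow_right two_pos (le_max_left (Nat.size a) (Nat.size b)))
  have hb := (Nat.lt_size_self b).trans_le
    (Nat.pow_le_pow_right two_pos (le_max_right (Nat.size a) (Nat.size b)))
  omega

theorem Nat.size_mul_le (a b : ℕ) : Nat.size (a * b) ≤ Nat.size a + Nat.size b := by
  rw [Nat.size_le, pow_add]
  exact Nat.mul_lt_mul'' (Nat.lt_size_self a) (Nat.lt_size_self b)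

theorem Nat.size_le_self (a : ℕ) : Nat.size a ≤ a :=
  Nat.size_le.2 Nat.lt_two_pow_self

namespace RAM

/-- All cells hold numbers of at most `B` bits. -/
def Mem.BitsLE (σ : Mem) (B : ℕ) : Prop := ∀ a i, Nat.size (σ a i) ≤ B

theorem Mem.BitsLE.mono {σ : Mem} {B C : ℕ} (h : σ.BitsLE B) (hBC : B ≤ C) : σ.BitsLE C :=
  fun a i => (h a i).trans hBC

theorem Mem.BitsLE.write {σ : Mem} {B a i v : ℕ} (h : σ.BitsLE B) (hv : Nat.size v ≤ B) :
    (σ.write a i v).BitsLE B := by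
  intro b j
  unfold Mem.write
  by_cases hb : b = a
  · subst hb
    by_cases hj : j = i
    · subst hj; simpa using hv
    · simpa [hj] using h b j
  · simpa [hb] using h b j

theorem Mem.write_of_ne {σ : Mem} {a b i v : ℕ} (h : b ≠ a) : σ.write a i v b = σ b := by
  simp [Mem.write, h]

theorem Mem.write_apply (σ : Mem) (a i v b j : ℕ) :
    σ.write a i v b j = if b = a ∧ j = i then v else σ b j := by
  unfold Mem.write
  by_cases hb : b = a
  · subst hb
    by_cases hj : j = i
    · subst hj; simp
    · simp [hj]
  · simp [hb]

namespace Expr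

/-- A constant that bounds bit lengths and costs of an expression. -/
def weight : Expr → ℕ
  | lit n => Nat.size n + 1
  | get _ i => 2 * i.weight + 1
  | add e f => 2 * e.weight + 2 * f.weight + 1
  | sub e f => 2 * e.weight + 2 * f.weight + 1
  | mul e f => 2 * e.weight + 2 * f.weight + 1

/-- Expressions without multiplications outside of addresses. -/
def MulFree : Expr → Prop
  | lit _ => True
  | get _ _ => True
  | add e f => e.MulFree ∧ f.MulFree
  | sub e f => e.MulFree ∧ f.MulFree
  | mul _ _ => False

theorem size_eval_le (e : Expr) {σ : Mem} {B : ℕ} (h : σ.BitsLE B) :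
    Nat.size (e.eval σ) ≤ e.weight * (B + 1) := by
  induction e with
  | lit n => simp only [eval, weight]; nlinarith
  | get a i ih => simp only [eval, weight]; nlinarith [h a (i.eval σ)]
  | add e f he hf =>
    have := Nat.size_add_le (e.eval σ) (f.eval σ)
    simp only [eval, weight]
    have : max (e.eval σ).size (f.eval σ).size ≤ (e.eval σ).size + (f.eval σ).size := by omega
    nlinarith
  | sub e f he hf =>
    have := Nat.size_le_size (Nat.sub_le (e.eval σ) (f.eval σ))
    simp only [eval, weight]
    nlinarith
  | mul e f he hf =>
    have := Nat.size_mul_le (e.eval σ) (f.eval σ)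
    simp only [eval, weight]
    nlinarith

theorem cost_le (e : Expr) {σ : Mem} {B : ℕ} (h : σ.BitsLE B) :
    e.cost σ ≤ e.weight * (B + 1) := by
  induction e with
  | lit n => simp only [cost, weight]; nlinarith
  | get a i ih =>
    simp only [cost, weight]
    nlinarith [h a (i.eval σ), i.size_eval_le h]
  | add e f he hf | sub e f he hf | mul e f he hf =>
    simp only [cost, weight]
    nlinarith [e.size_eval_le h, f.size_eval_le h]

/-- The bound is additive in `B`, unlike that of `size_eval_le`; this is what survives iteration,
since repeated squaring would double the length in every round. A product inside an address is
harmless, because the value read there has at most `B` bits anyway. -/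
theorem MulFree.size_eval_le {e : Expr} (he : e.MulFree) {σ : Mem} {B : ℕ} (h : σ.BitsLE B) :
    Nat.size (e.eval σ) ≤ B + e.weight := by
  induction e with
  | lit n => simp only [eval, weight]; omega
  | get a i ih => simp only [eval, weight]; have := h a (i.eval σ); omega
  | add e f ihe ihf =>
    have := Nat.size_add_le (e.eval σ) (f.eval σ)
    have := ihe he.1
    have := ihf he.2
    simp only [eval, weight]
    omega
  | sub e f ihe ihf =>
    have := Nat.size_le_size (Nat.sub_le (e.eval σ) (f.eval σ))
    have := ihe he.1
    simp only [eval, weight]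
    omega
  | mul e f => exact he.elim

end Expr

/-! ### Structured programs with bounded loops -/

/-- Structured programs; `count y j c` runs `c` with the counter `y[0]` running down from
`N - 1` to `0`, where `N` is the content of cell `j` of the input. -/
inductive Code : Type
  | skip : Code
  | store (a : ℕ) (i e : Expr) : Code
  | seq (c d : Code) : Code
  | branch (e : Expr) (c d : Code) : Code
  | count (y j : ℕ) (c : Code) : Code

/-- Iterate `f`, with cell `y[0]` counting down from `N - 1` to `0`. -/
def countdown (f : Mem → Mem) (y : ℕ) : ℕ → Mem → Mem
  | 0, σ => σ
  | i + 1, σ => countdown f y i (f (σ.write y 0 i))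

theorem countdown_induction {f : Mem → Mem} {y : ℕ} (P : ℕ → Mem → Prop) {N : ℕ}
    (step : ∀ i < N, ∀ σ, P (i + 1) σ → P i (f (σ.write y 0 i))) {σ : Mem} (h : P N σ) :
    P 0 (countdown f y N σ) := by
  induction N generalizing σ with
  | zero => exact h
  | succ i ih => exact ih (fun j hj => step j (by omega)) (step i (by omega) σ h)

namespace Code

/-- The underlying random access machine program. -/
def toProg : Code → Prog
  | skip => .skip
  | store a i e => .store a i e
  | seq c d => .seq c.toProg d.toProg
  | branch e c d => .branch e c.toProg d.toProg
  | count y j c => .seq (.store y (.lit 0) (.get 0 (.lit j)))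
      (.loop (.get y (.lit 0)) (.seq (.store y (.lit 0) (.sub (.get y (.lit 0)) (.lit 1))) c.toProg))

/-- The effect of a structured program. -/
def run : Code → Mem → Mem
  | skip, σ => σ
  | store a i e, σ => σ.write a (i.eval σ) (e.eval σ)
  | seq c d, σ => d.run (c.run σ)
  | branch e c d, σ => if e.eval σ ≠ 0 then c.run σ else d.run σ
  | count y j c, σ => countdown c.run y (σ 0 j) (σ.write y 0 (σ 0 j))

/-- The arrays that a program may modify. -/
def writes : Code → List ℕ
  | skip => []
  | store a _ _ => [a]
  | seq c d => c.writes ++ d.writes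
  | branch _ c d => c.writes ++ d.writes
  | count y _ c => y :: c.writes

/-- Well-formed programs do not touch the input and their running counters, they count down only
from the first two entries of the input, and they store no products. -/
def WF : Code → Prop
  | skip => True
  | store a _ e => a ≠ 0 ∧ e.MulFree
  | seq c d => c.WF ∧ d.WF
  | branch _ c d => c.WF ∧ d.WF
  | count y j c => y ≠ 0 ∧ y ∉ c.writes ∧ (j = 1 ∨ j = 2) ∧ c.WF

theorem run_of_notMem_writes (c : Code) {a : ℕ} (ha : a ∉ c.writes) (σ : Mem) :
    c.run σ a = σ a := by
  induction c generalizing σ with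
  | skip => rfl
  | store b i e =>
    simp only [writes, List.mem_singleton] at ha
    exact Mem.write_of_ne ha
  | seq c d hc hd =>
    simp only [writes, List.mem_append, not_or] at ha
    simp only [run]
    rw [hd ha.2, hc ha.1]
  | branch e c d hc hd =>
    simp only [writes, List.mem_append, not_or] at ha
    simp only [run]
    split
    · exact hc ha.1 σ
    · exact hd ha.2 σ
  | count y j c hc =>
    simp only [writes, List.mem_cons, not_or] at ha
    simp only [run]
    refine countdown_induction (fun _ τ => τ a = σ a) ?_ (Mem.write_of_ne ha.1)
    intro i _ τ hτ
    rw [hc ha.2, Mem.write_of_ne ha.1, hτ]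

theorem WF.zero_notMem_writes {c : Code} (h : c.WF) : 0 ∉ c.writes := by
  induction c with
  | skip => simp [writes]
  | store a i e => simpa [writes] using h.1.symm
  | seq c d hc hd | branch e c d hc hd => simp [writes, hc h.1, hd h.2]
  | count y j c hc => simpa [writes] using ⟨h.1.symm, hc h.2.2.2⟩

theorem WF.run_zero {c : Code} (h : c.WF) (σ : Mem) : c.run σ 0 = σ 0 :=
  c.run_of_notMem_writes h.zero_notMem_writes σ

/-- A bound for the growth of bit lengths. -/
noncomputable def growth : Code → Polynomial ℕ
  | skip => 0
  | store _ _ e => Polynomial.C e.weight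
  | seq c d => c.growth + d.growth
  | branch _ c d => c.growth + d.growth
  | count _ _ c => Polynomial.X * c.growth

/-- A bound for the running time per bit. -/
noncomputable def time : Code → Polynomial ℕ
  | skip => 1
  | store _ i e => Polynomial.C (2 * i.weight + 2 * e.weight + 1)
  | seq c d => c.time + d.time * (c.growth + 1) + 1
  | branch e c d => Polynomial.C (e.weight + 1) + c.time + d.time
  | count _ j c => Polynomial.C (2 * Nat.size j + 100) * (Polynomial.X * c.growth + 1) +
      Polynomial.X * ((c.time + 50) * (Polynomial.X * c.growth + 1))

/-- Every round raises the bit bound by at most `g`, so all `i` rounds run under the bound `B + i *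
g`. The constants 50 generously cover the loop test and the decrement. The body leaves the input and
the counter alone, so its hypotheses hold again in the next round. -/
theorem exec_loop {c : Code} {y g a N : ℕ} (hy : y ∉ c.writes)
    (hc : ∀ (σ : Mem) (B : ℕ), σ 0 1 ≤ N → σ 0 2 ≤ N → σ.BitsLE B → (c.run σ).BitsLE (B + g) ∧
      ∃ t ≤ a * (B + 1), Exec c.toProg σ (c.run σ) t)
    (h0 : 0 ∉ c.writes) (hy0 : y ≠ 0) (i : ℕ) (σ : Mem) (B : ℕ) (h1 : σ 0 1 ≤ N) (h2 : σ 0 2 ≤ N)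
    (hB : σ.BitsLE B) (hi : σ y 0 = i) :
    (countdown c.run y i σ).BitsLE (B + i * g) ∧
      ∃ t ≤ 50 * (B + i * g + 1) + i * ((a + 50) * (B + i * g + 1)),
        Exec (.loop (.get y (.lit 0))
          (.seq (.store y (.lit 0) (.sub (.get y (.lit 0)) (.lit 1))) c.toProg))
          σ (countdown c.run y i σ) t := by
  induction i generalizing σ B with
  | zero =>
    refine ⟨by simpa [countdown] using hB, _, ?_, .loop_done (by simpa [Expr.eval] using hi)⟩
    have := Expr.cost_le (.get y (.lit 0)) hB
    simp only [Expr.weight, Nat.size_zero] at this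
    omega
  | succ i ih =>
    have hsz : Nat.size i ≤ B := (Nat.size_le_size (by omega)).trans (hB y 0)
    have hB' := hB.write (a := y) (i := 0) hsz
    have hz : ∀ j, σ.write y 0 i 0 j = σ 0 j := fun j => by rw [Mem.write_of_ne hy0.symm]
    obtain ⟨hg, s, hs, hcs⟩ := hc (σ.write y 0 i) B (by rwa [hz]) (by rwa [hz]) hB'
    have hrz : ∀ j, c.run (σ.write y 0 i) 0 j = σ 0 j := fun j => by
      rw [c.run_of_notMem_writes h0, hz]
    obtain ⟨hG, t, ht, het⟩ := ih (c.run (σ.write y 0 i)) (B + g) (by rwa [hrz]) (by rwa [hrz]) hg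
      (by rw [c.run_of_notMem_writes hy, Mem.write_apply]; simp)
    refine ⟨by simpa [countdown, add_mul, add_assoc, add_comm g] using hG, ?_⟩
    have e1 := Exec.store σ y (.lit 0) (.sub (.get y (.lit 0)) (.lit 1))
    have hev : (Expr.sub (.get y (.lit 0)) (.lit 1)).eval σ = i := by simp [Expr.eval, hi]
    have hev' : (Expr.lit 0).eval σ = 0 := rfl
    rw [hev, hev'] at e1
    refine ⟨_, ?_, .loop_step (by simp [Expr.eval, hi]) (.seq e1 hcs) het⟩
    have c1 := Expr.cost_le (.get y (.lit 0)) hB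
    have c2 := Expr.cost_le (.sub (.get y (.lit 0)) (.lit 1)) hB
    have c3 := Expr.cost_le (.lit 0) hB
    simp only [Expr.weight, Nat.size_zero, Nat.size_one] at c1 c2 c3
    have e : B + g + i * g = B + (i + 1) * g := by ring
    rw [e] at ht
    have hle : B + 1 ≤ B + (i + 1) * g + 1 := by omega
    have h5 : a * (B + 1) ≤ a * (B + (i + 1) * g + 1) := Nat.mul_le_mul_left _ hle
    simp only [Nat.size_zero]
    nlinarith

/-- Growth and time are bounded together, because the cost of a command depends on the bit lengths
left by its predecessors. Growth adds up along a sequence and is multiplied by at most `N` in a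
loop. -/
theorem WF.exec {c : Code} (h : c.WF) {N : ℕ} (σ : Mem) (B : ℕ) (h1 : σ 0 1 ≤ N)
    (h2 : σ 0 2 ≤ N) (hB : σ.BitsLE B) :
    (c.run σ).BitsLE (B + c.growth.eval N) ∧
      ∃ t ≤ c.time.eval N * (B + 1), Exec c.toProg σ (c.run σ) t := by
  induction c generalizing σ B with
  | skip => exact ⟨by simpa [run, growth] using hB, 1, by simp [time], .skip σ⟩
  | store a i e =>
    refine ⟨?_, _, ?_, .store σ a i e⟩
    · simp only [growth, Polynomial.eval_C]
      exact (hB.mono (by omega)).write (h.2.size_eval_le hB)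
    · simp only [time, Polynomial.eval_C]
      nlinarith [i.cost_le hB, e.cost_le hB, i.size_eval_le hB, e.size_eval_le hB]
  | seq c d hc hd =>
    obtain ⟨g1, s, hs, e1⟩ := hc h.1 σ B h1 h2 hB
    obtain ⟨g2, t, ht, e2⟩ := hd h.2 (c.run σ) _ (by rwa [h.1.run_zero]) (by rwa [h.1.run_zero]) g1
    refine ⟨g2.mono (by simp [growth, add_assoc]), _, ?_, .seq e1 e2⟩
    simp only [time, Polynomial.eval_add, Polynomial.eval_mul, Polynomial.eval_one]
    have : d.time.eval N * (B + c.growth.eval N + 1)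
        ≤ d.time.eval N * ((c.growth.eval N + 1) * (B + 1)) :=
      Nat.mul_le_mul_left _ (by nlinarith)
    nlinarith
  | branch e c d hc hd =>
    have := e.cost_le hB
    obtain ⟨g1, s, hs, e1⟩ := hc h.1 σ B h1 h2 hB
    obtain ⟨g2, t, ht, e2⟩ := hd h.2 σ B h1 h2 hB
    simp only [run, growth, time, Polynomial.eval_add, Polynomial.eval_C]
    split
    · refine ⟨g1.mono (by omega), _, ?_, .branch_true ‹_› e1⟩
      nlinarith
    · refine ⟨g2.mono (by omega), _, ?_, .branch_false (not_not.1 ‹_›) e2⟩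
      nlinarith
  | count y j c hc =>
    obtain ⟨hy0, hy, hj, hwf⟩ := h
    have hB' := hB.write (a := y) (i := 0) (hB 0 j)
    have hz : ∀ k, σ.write y 0 (σ 0 j) 0 k = σ 0 k := fun k => by rw [Mem.write_of_ne hy0.symm]
    obtain ⟨hg, t, ht, e⟩ := exec_loop hy (fun τ C k1 k2 hC => hc hwf τ C k1 k2 hC)
      hwf.zero_notMem_writes hy0 (σ 0 j) _ B (by rwa [hz]) (by rwa [hz]) hB'
      (by simp [Mem.write_apply])
    have hjN : σ 0 j ≤ N := by rcases hj with rfl | rfl <;> assumption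
    have hmul : σ 0 j * c.growth.eval N ≤ N * c.growth.eval N := Nat.mul_le_mul_right _ hjN
    refine ⟨hg.mono (by simpa [growth] using hmul), _, ?_, .seq (.store σ y _ _) e⟩
    have c1 := Expr.cost_le (.get 0 (.lit j)) hB
    have c2 := Expr.cost_le (.lit 0) hB
    have s1 := hB 0 j
    simp only [Expr.weight, Nat.size_zero] at c1 c2
    simp only [Expr.eval, Nat.size_zero, time, Polynomial.eval_add, Polynomial.eval_mul,
      Polynomial.eval_C, Polynomial.eval_X, Polynomial.eval_one, Polynomial.eval_ofNat]
    set M := N * c.growth.eval N + 1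
    -- A sum of `B` and a polynomial in `N` is bounded by a product, which keeps the time bound
    -- linear in `B + 1`.
    have hM : B + σ 0 j * c.growth.eval N + 1 ≤ M * (B + 1) := by
      have : M * (B + 1) = N * c.growth.eval N * B + (B + N * c.growth.eval N + 1) := by ring
      omega
    have k1 : σ 0 j * ((c.time.eval N + 50) * (B + σ 0 j * c.growth.eval N + 1)) ≤
        N * ((c.time.eval N + 50) * (M * (B + 1))) :=
      Nat.mul_le_mul hjN (Nat.mul_le_mul_left _ hM)
    have k2 : B + 1 ≤ M * (B + 1) := Nat.le_mul_of_pos_left _ (Nat.succ_pos _)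
    have k3 : (2 * Nat.size j) * (B + 1) ≤ (2 * Nat.size j) * (M * (B + 1)) :=
      Nat.mul_le_mul_left _ k2
    nlinarith

end Code

end RAM

/-! ### Greedy trees, the exchange argument, and the number of edges of a tree -/

namespace Graph

variable {α β : Type*}

/-- `x` and `y` are joined by a walk all of whose edges are in `F`. -/
def Joined (G : Graph α β) (F : Set β) : α → α → Prop :=
  Relation.ReflTransGen fun x y => ∃ e ∈ F, G.IsLink e x y

variable {G : Graph α β} {F : Set β}

theorem Joined.mono {F' : Set β} (h : F ⊆ F') {x y : α} (hxy : G.Joined F x y) :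
    G.Joined F' x y :=
  Relation.ReflTransGen.mono (fun _ _ ⟨e, he, hl⟩ => ⟨e, h he, hl⟩) _ _ hxy

theorem Joined.symm {x y : α} (h : G.Joined F x y) : G.Joined F y x := by
  induction h with
  | refl => exact .refl
  | tail _ hbc ih =>
    obtain ⟨e, he, hl⟩ := hbc
    exact .head ⟨e, he, hl.symm⟩ ih

theorem IsLink.joined {e : β} {x y : α} (h : G.IsLink e x y) (he : e ∈ F) : G.Joined F x y :=
  .single ⟨e, he, h⟩

theorem Joined.trans {x y z : α} (h : G.Joined F x y) (h' : G.Joined F y z) : G.Joined F x z :=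
  Relation.ReflTransGen.trans h h'

/-- A walk that enters `R` has a first edge that enters `R`. -/
theorem Joined.exists_entering {R : Set α} {a b : α} (h : G.Joined F b a) (hb : b ∉ R)
    (ha : a ∈ R) : ∃ f ∈ F, ∃ x y, G.IsLink f x y ∧ x ∉ R ∧ y ∈ R ∧ G.Joined (F \ {f}) b x := by
  -- Invariant along the walk: as long as `R` has not been entered, all edges used have both ends
  -- outside `R`. The entering edge is therefore not among them, which allows its removal from `F`.
  suffices H : (a ∉ R ∧ G.Joined {e ∈ F | ∀ x y, G.IsLink e x y → x ∉ R} b a) ∨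
      ∃ f ∈ F, ∃ x y, G.IsLink f x y ∧ x ∉ R ∧ y ∈ R ∧ G.Joined (F \ {f}) b x from
    H.resolve_left fun h => h.1 ha
  clear ha
  induction h with
  | refl => exact .inl ⟨hb, .refl⟩
  | @tail c d _ hcd ih =>
    obtain ⟨hc, hj⟩ | h := ih
    · obtain ⟨e, he, hl⟩ := hcd
      by_cases hd : d ∈ R
      · refine .inr ⟨e, he, c, d, hl, hc, hd, hj.mono ?_⟩
        rintro f ⟨hf, hfR⟩
        refine ⟨hf, ?_⟩
        rintro rfl
        exact hfR _ _ hl.symm hd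
      · refine .inl ⟨hd, hj.tail ⟨e, ⟨he, fun x y hxy => ?_⟩, hl⟩⟩
        obtain rfl | rfl := hxy.left_eq_or_eq hl <;> assumption
    · exact .inr h

/-- If `e` is not in `F`, a walk in `F` from `b` to `a` enters `R` by an edge `f` from `x` to `y`.
It lies outside `P`, since `x` is outside `R`, and it is no heavier than `e`. Trading `f` for `e`
keeps everything joined: `x` reaches `b` without `f`, then `e` leads to `a`, and `P` joins `a` to
`y`. -/
theorem exists_exchange [DecidableEq β] {R : Set α} {P F : Finset β} {w : β → ℚ} {a b : α} {e : β}
    (hPF : P ⊆ F) (hPR : ∀ f ∈ P, ∀ x y, G.IsLink f x y → x ∈ R)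
    (hR : ∀ x ∈ R, ∀ y ∈ R, G.Joined P x y) (hF : ∀ x y, G.Joined F x y)
    (he : G.IsLink e a b) (ha : a ∈ R) (hb : b ∉ R)
    (hmax : ∀ f x y, G.IsLink f x y → x ∈ R → y ∉ R → w f ≤ w e) :
    ∃ F' : Finset β, insert e P ⊆ F' ∧ (∀ x y, G.Joined F' x y) ∧ F'.card ≤ F.card ∧
      ∑ f ∈ F, w f ≤ ∑ f ∈ F', w f := by
  by_cases heF : e ∈ F
  · exact ⟨F, Finset.insert_subset heF hPF, hF, le_rfl, le_rfl⟩
  obtain ⟨f, hf, x, y, hl, hx, hy, hj⟩ := (hF b a).exists_entering hb ha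
  have hfP : f ∉ P := fun h => hx (hPR f h x y hl)
  have heq : e ∉ F.erase f := fun h => heF (Finset.mem_of_mem_erase h)
  have hPF' : P ⊆ F.erase f := fun p hp =>
    Finset.mem_erase.2 ⟨fun h => hfP (h ▸ hp), hPF hp⟩
  refine ⟨insert e (F.erase f), Finset.insert_subset_insert _ hPF', ?_, ?_, ?_⟩
  · have hxy : G.Joined (insert e (F.erase f) : Finset β) x y := by
      have h1 : G.Joined (insert e (F.erase f) : Finset β) x b :=
        hj.symm.mono (by intro p; simp; tauto)
      have h2 : G.Joined (insert e (F.erase f) : Finset β) b a :=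
        he.symm.joined (by simp)
      have h3 : G.Joined (insert e (F.erase f) : Finset β) a y :=
        (hR a ha y hy).mono (by
          intro p hp
          exact Finset.mem_coe.2 (Finset.mem_insert_of_mem (hPF' hp)))
      exact (h1.trans h2).trans h3
    intro u v
    induction hF u v with
    | refl => exact .refl
    | @tail c d _ hcd ih =>
      refine ih.trans ?_
      obtain ⟨p, hp, hpl⟩ := hcd
      by_cases hpf : p = f
      · subst hpf
        obtain ⟨rfl, rfl⟩ | ⟨rfl, rfl⟩ := hpl.eq_and_eq_or_eq_and_eq hl
        · exact hxy
        · exact hxy.symm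
      · exact hpl.joined (by simp [hpf]; exact .inr hp)
  · rw [Finset.card_insert_of_notMem heq, Finset.card_erase_add_one hf]
  · rw [Finset.sum_insert heq, ← Finset.add_sum_erase F w hf]
    have := hmax f y x hl.symm hy hx
    linarith

/-- The edge set `P` is a tree with vertex set `R` that extends to a maximum weight spanning
tree. -/
structure IsGreedy (G : Graph α β) (w : β → ℚ) (R : Set α) (P : Finset β) : Prop where
  inside : ∀ f ∈ P, ∀ x y, G.IsLink f x y → x ∈ R
  joined : ∀ x ∈ R, ∀ y ∈ R, G.Joined P x y
  card : P.card + 1 = R.ncard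
  opt : ∀ F : Finset β, (∀ x y, G.Joined F x y) → ∃ F' : Finset β, P ⊆ F' ∧
    (∀ x y, G.Joined F' x y) ∧ F'.card ≤ F.card ∧ ∑ f ∈ F, w f ≤ ∑ f ∈ F', w f

theorem IsGreedy.singleton (G : Graph α β) (w : β → ℚ) (r : α) : G.IsGreedy w {r} ∅ where
  inside := by simp
  joined := by rintro x rfl y rfl; exact .refl
  card := by simp
  opt F hF := ⟨F, by simp, hF, le_rfl, le_rfl⟩

theorem IsGreedy.insert [DecidableEq β] [Finite α] {w : β → ℚ} {R : Set α} {P : Finset β}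
    (h : G.IsGreedy w R P) {a b : α} {e : β} (he : G.IsLink e a b) (ha : a ∈ R) (hb : b ∉ R)
    (hmax : ∀ f x y, G.IsLink f x y → x ∈ R → y ∉ R → w f ≤ w e) :
    G.IsGreedy w (insert b R) (insert e P) where
  inside := by
    intro f hf x y hl
    rcases Finset.mem_insert.1 hf with rfl | hf
    · obtain rfl | rfl := hl.left_eq_or_eq he
      · exact .inr ha
      · exact .inl rfl
    · exact .inr (h.inside f hf x y hl)
  joined := by
    have key : ∀ x ∈ Insert.insert b R, G.Joined (Insert.insert e P : Finset β) a x := by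
      rintro x (rfl | hx)
      · exact he.joined (by simp)
      · exact (h.joined a ha x hx).mono (by simp)
    exact fun x hx y hy => (key x hx).symm.trans (key y hy)
  card := by
    rw [Set.ncard_insert_of_notMem hb (Set.toFinite _), Finset.card_insert_of_notMem, h.card]
    exact fun heP => hb (h.inside e heP b a he.symm)
  opt F hF := by
    obtain ⟨F₁, hP, hF₁, hc, hs⟩ := h.opt F hF
    obtain ⟨F₂, hP', hF₂, hc', hs'⟩ :=
      exists_exchange hP h.inside h.joined hF₁ he ha hb hmax
    exact ⟨F₂, hP', hF₂, hc'.trans hc, hs.trans hs'⟩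

/-- The improved set `F'` contains `P` and has at most `Nat.card α - 1` edges, which is the size of
`P`; hence `F' = P`. For this reason `opt` also controls the cardinality. -/
theorem IsGreedy.sum_le {w : β → ℚ} {P F : Finset β} (h : G.IsGreedy w Set.univ P)
    (hF : ∀ x y, G.Joined F x y) (hc : F.card + 1 ≤ Nat.card α) :
    ∑ f ∈ F, w f ≤ ∑ f ∈ P, w f := by
  obtain ⟨F', hP, -, hc', hs⟩ := h.opt F hF
  have hcard := h.card
  rw [Set.ncard_univ] at hcard
  rwa [← Finset.eq_of_subset_of_card_le hP (by omega)] at hs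

/-- The walk is shortened to a path in an auxiliary simple graph, and `e` closes it. For a loop `e`
the path has length zero. Two path edges cannot coincide, since their ends would then agree in one
of the two orders. -/
theorem exists_isCyc_of_joined {e : β} {x y : α} (he : G.IsLink e x y)
    (h : G.Joined (F \ {e}) y x) :
    ∃ (k : ℕ) (u : Fin (k + 1) → α) (d : Fin (k + 1) → β), G.IsCyc u d := by
  classical
  let H : SimpleGraph α := SimpleGraph.fromRel fun x y => ∃ f ∈ F \ {e}, G.IsLink f x y
  have hH : ∀ {u v}, H.Adj u v → ∃ f ∈ F \ {e}, G.IsLink f u v := by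
    rintro u v ⟨-, h | ⟨f, hf, hl⟩⟩
    · exact h
    · exact ⟨f, hf, hl.symm⟩
  have hr : H.Reachable y x := by
    clear he
    induction h with
    | refl => exact .refl _
    | @tail b c _ hbc ih =>
      by_cases hne : b = c
      · exact hne ▸ ih
      · exact ih.trans (SimpleGraph.Adj.reachable ⟨hne, .inl hbc⟩)
  obtain ⟨p, hp⟩ := hr.exists_isPath
  have hadj : ∀ i, ∃ f, i < p.length → f ∈ F \ {e} ∧ G.IsLink f (p.getVert i) (p.getVert (i + 1)) := by
    intro i
    by_cases hi : i < p.length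
    · obtain ⟨f, hf, hl⟩ := hH (p.adj_getVert_succ hi)
      exact ⟨f, fun _ => ⟨hf, hl⟩⟩
    · exact ⟨e, fun h => absurd h hi⟩
  choose d hd using hadj
  have hinj : ∀ {i j}, i ≤ p.length → j ≤ p.length → p.getVert i = p.getVert j → i = j :=
    fun hi hj h => hp.getVert_injOn hi hj h
  -- The last index carries `e`, whose far end is `p.getVert 0` by the cyclic addition in `Fin`.
  refine ⟨p.length, fun i => p.getVert i, fun i => if (i : ℕ) < p.length then d i else e, ?_, ?_, ?_⟩
  · intro i j h
    exact Fin.ext (hinj (Nat.lt_succ_iff.1 i.2) (Nat.lt_succ_iff.1 j.2) h)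
  · intro i j h
    have hi := i.2
    have hj := j.2
    ext
    dsimp only at h
    split_ifs at h with h1 h2 h2
    · have l1 := (hd i h1).2
      have l2 := (hd j h2).2
      rw [h] at l1
      rcases l1.eq_and_eq_or_eq_and_eq l2 with ⟨h3, -⟩ | ⟨h3, h4⟩
      · exact hinj (by omega) (by omega) h3
      · have := hinj (by omega) (by omega) h3
        have := hinj (by omega) (by omega) h4
        omega
    · exact absurd h (hd i h1).1.2
    · exact absurd h.symm (hd j h2).1.2
    · omega
  · intro i
    dsimp only
    split_ifs with h1
    · have : ((i + 1 : Fin (p.length + 1)) : ℕ) = i + 1 := by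
        rw [Fin.val_add_one_of_lt]
        exact h1
      rw [this]
      exact (hd i h1).2
    · have hi : i = Fin.last p.length := by
        ext; have := i.2; simp; omega
      subst hi
      simpa using he

/-- A spanning tree `F` of `T` is grown vertex by vertex; with weight 0 every edge is a greedy
choice. An edge of `T` outside `F` would close a cycle, so `F` contains all of `E(T)`. -/
theorem IsTree.ncard_edgeSet_lt [Finite α] [Finite β] {T : Graph α β} (hT : T.IsTree) :
    E(T).ncard + 1 ≤ V(T).ncard := by
  classical
  obtain ⟨⟨⟨r, hr⟩, hconn⟩, hcyc⟩ := hT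
  have hE : ∀ x ∈ V(T), ∀ y ∈ V(T), T.Joined E(T) x y := fun x hx y hy =>
    Relation.ReflTransGen.mono (fun _ _ ⟨e, h⟩ => ⟨e, h.edge_mem, h⟩) _ _ (hconn x hx y hy)
  have grow : ∀ j, j < V(T).ncard → ∃ (R : Set α) (F : Finset β), R ⊆ V(T) ∧
      R.ncard = j + 1 ∧ r ∈ R ∧ T.IsGreedy 0 R F := by
    intro j hj
    induction j with
    | zero => exact ⟨{r}, ∅, by simpa using hr, by simp, rfl, .singleton T 0 r⟩
    | succ j ih =>
      obtain ⟨R, F, hRV, hR, hrR, hF⟩ := ih (by omega)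
      obtain ⟨b, hbV, hbR⟩ : ∃ b ∈ V(T), b ∉ R := by
        by_contra! h
        have := Set.ncard_le_ncard h (Set.toFinite _)
        omega
      obtain ⟨f, hf, x, y, hl, hx, hy, -⟩ := (hE b hbV r hr).exists_entering hbR hrR
      refine ⟨insert x R, insert f F, Set.insert_subset hl.left_mem hRV, ?_, .inr hrR,
        hF.insert hl.symm hy hx (by simp)⟩
      rw [Set.ncard_insert_of_notMem hx (Set.toFinite _), hR]
  have hpos : 0 < V(T).ncard := (Set.ncard_pos (Set.toFinite _)).2 ⟨r, hr⟩
  obtain ⟨R, F, hRV, hR, hrR, hF⟩ := grow (V(T).ncard - 1) (by omega)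
  have hRV' : R = V(T) := Set.eq_of_subset_of_ncard_le hRV (by omega) (Set.toFinite _)
  subst hRV'
  have : E(T) ⊆ F := by
    intro e he
    by_contra heF
    obtain ⟨x, y, hl⟩ := exists_isLink_of_mem_edgeSet he
    obtain ⟨k, u, d, h⟩ := exists_isCyc_of_joined (F := F) hl
      ((hF.joined y hl.right_mem x hl.left_mem).mono (by
        intro p hp
        refine ⟨hp, ?_⟩
        rintro rfl
        exact heF hp))
    exact hcyc k u d h
  have := Set.ncard_le_ncard this (Set.toFinite _)
  rw [Set.ncard_coe_finset] at this
  have := hF.card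
  omega

end Graph

/-! ### The rooted graph and its relation to packings -/

namespace Graph

variable {α β : Type*}

/-- The graph `G` with a new vertex `none` that is joined to all vertices in `S`. -/
def rooted (G : Graph α β) (S : Set α) : Graph (Option α) (β ⊕ α) where
  vertexSet := Set.univ
  IsLink d x y := (∃ e u v, d = .inl e ∧ x = some u ∧ y = some v ∧ G.IsLink e u v) ∨
    ∃ s ∈ S, d = .inr s ∧ (x = none ∧ y = some s ∨ x = some s ∧ y = none)
  isLink_symm := by
    rintro d -
    refine ⟨fun x y h => ?_⟩
    rcases h with ⟨e, u, v, rfl, rfl, rfl, h⟩ | ⟨s, hs, rfl, h⟩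
    · exact .inl ⟨e, v, u, rfl, rfl, rfl, h.symm⟩
    · exact .inr ⟨s, hs, rfl, by tauto⟩
  eq_or_eq_of_isLink_of_isLink := by
    rintro d x y x' y' (⟨e, u, v, rfl, rfl, rfl, h⟩ | ⟨s, hs, rfl, h⟩)
      (⟨e', u', v', he, rfl, rfl, h'⟩ | ⟨s', hs', he, h'⟩)
    · obtain rfl : e = e' := by simpa using he
      simpa using h.left_eq_or_eq h'
    · simp at he
    · simp at he
    · obtain rfl : s = s' := by simpa using he
      rcases h with ⟨rfl, rfl⟩ | ⟨rfl, rfl⟩ <;> rcases h' with ⟨rfl, rfl⟩ | ⟨rfl, rfl⟩ <;> simp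
  left_mem_of_isLink := fun _ _ _ _ => Set.mem_univ _

variable {G : Graph α β} {S : Set α}

theorem IsLink.rooted {e : β} {u v : α} (h : G.IsLink e u v) :
    (G.rooted S).IsLink (.inl e) (some u) (some v) :=
  .inl ⟨e, u, v, rfl, rfl, rfl, h⟩

theorem rooted_isLink_none {s : α} (hs : s ∈ S) : (G.rooted S).IsLink (.inr s) none (some s) :=
  .inr ⟨s, hs, rfl, .inl ⟨rfl, rfl⟩⟩

/-- `F` consists of all edges of the trees and one edge from `none` into each tree. A tree has fewer
edges than vertices, so the `k` extra edges still leave at most `Fintype.card α` in total. -/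
theorem IsSTreePacking.exists_joined [Fintype α] [Fintype β] {k : ℕ} {T : Fin k → Graph α β}
    (h : G.IsSTreePacking S T) (hV : V(G) = Set.univ) (w : β → ℚ) :
    ∃ F : Finset (β ⊕ α), (∀ x y, (G.rooted S).Joined F x y) ∧ F.card + 1 ≤ Nat.card (Option α) ∧
      ∑ d ∈ F, Sum.elim w (fun _ => 0) d = packingWeight w T := by
  classical
  choose s hs using h.meets
  have hmem : ∀ {i j x}, x ∈ V(T i) → x ∈ V(T j) → i = j := by
    intro i j x hi hj
    by_contra hij
    exact (h.disjoint i j hij).le_bot ⟨hi, hj⟩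
  have hdisj : ∀ i j, i ≠ j → Disjoint ({e | e ∈ E(T i)} : Finset β)
      ({e | e ∈ E(T j)} : Finset β) := by
    intro i j hij
    rw [Finset.disjoint_left]
    intro e he he'
    obtain ⟨x, y, hl⟩ := exists_isLink_of_mem_edgeSet (Finset.mem_filter.1 he).2
    obtain ⟨x', y', hl'⟩ := exists_isLink_of_mem_edgeSet (Finset.mem_filter.1 he').2
    obtain rfl | rfl := (hl.mono (h.le i)).left_eq_or_eq (hl'.mono (h.le j))
    · exact hij (hmem hl.left_mem hl'.left_mem)
    · exact hij (hmem hl.left_mem hl'.right_mem)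
  let A : Finset β := Finset.univ.biUnion fun i => ({e | e ∈ E(T i)} : Finset β)
  refine ⟨A.disjSum (Finset.univ.image s), ?_, ?_, ?_⟩
  · have key : ∀ x, (G.rooted S).Joined (A.disjSum (Finset.univ.image s)) none x := by
      rintro (- | v)
      · exact .refl
      obtain ⟨i, hi⟩ : ∃ i, v ∈ V(T i) := by
        rw [← Set.mem_iUnion, h.spanning, hV]
        trivial
      have h1 : (G.rooted S).Joined (A.disjSum (Finset.univ.image s)) none (some (s i)) :=
        (rooted_isLink_none (hs i).2).joined (by simp)
      refine h1.trans ?_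
      induction (h.isTree i).1.2 _ (hs i).1 _ hi with
      | refl => exact .refl
      | tail _ hbc ih =>
        obtain ⟨e, hl⟩ := hbc
        refine (ih hl.left_mem).trans ((hl.mono (h.le i)).rooted.joined ?_)
        simpa [A] using ⟨i, hl.edge_mem⟩
    exact fun x y => (key x).symm.trans (key y)
  · have hA : A.card ≤ ∑ i, E(T i).ncard := by
      refine Finset.card_biUnion_le.trans_eq (Finset.sum_congr rfl fun i _ => ?_)
      rw [← Set.ncard_coe_finset]
      simp
    have hB : (Finset.univ.image s).card ≤ k := Finset.card_image_le.trans_eq (by simp)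
    have hT : ∑ i, (E(T i).ncard + 1) ≤ ∑ i, V(T i).ncard :=
      Finset.sum_le_sum fun i _ => (h.isTree i).ncard_edgeSet_lt
    have hC : ∑ i, V(T i).ncard ≤ Fintype.card α := by
      have : ∑ i, V(T i).ncard
          = (Finset.univ.biUnion fun i => ({v | v ∈ V(T i)} : Finset α)).card := by
        rw [Finset.card_biUnion]
        · refine Finset.sum_congr rfl fun i _ => ?_
          rw [← Set.ncard_coe_finset]
          simp
        · intro i _ j _ hij
          rw [Function.onFun, Finset.disjoint_left]
          intro v hv hv'
          exact hij (hmem (Finset.mem_filter.1 hv).2 (Finset.mem_filter.1 hv').2)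
      rw [this]
      exact Finset.card_le_univ _
    rw [Finset.sum_add_distrib] at hT
    simp only [Finset.sum_const, Finset.card_univ, Fintype.card_fin, smul_eq_mul, mul_one] at hT
    rw [Finset.card_disjSum, Nat.card_eq_fintype_card, Fintype.card_option]
    omega
  · rw [Finset.sum_disjSum]
    simp only [Sum.elim_inl, Sum.elim_inr, Finset.sum_const_zero, add_zero, packingWeight]
    exact Finset.sum_biUnion fun i _ j _ hij => hdisj i j hij

/-- If no edge leaves the set of labelled vertices, then there is no packing. -/
theorem not_exists_isSTreePacking [Fintype α] [Fintype β] (hV : V(G) = Set.univ)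
    {f : α → ℕ} {v : α}
    (hv : f v = 0) (hS : ∀ s ∈ S, f s ≠ 0)
    (hE : ∀ e u v, G.IsLink e u v → f u ≠ 0 → f v ≠ 0) :
    ¬ ∃ (k : ℕ) (T : Fin k → Graph α β), G.IsSTreePacking S T := by
  rintro ⟨k, T, hT⟩
  obtain ⟨F, hF, -⟩ := hT.exists_joined hV 0
  -- `R` consists of `none` and the labelled vertices; a walk from `v` to `none` would have to enter
  -- it, but no edge does.
  obtain ⟨_, _, x, y, hl, hx, hy, -⟩ := (hF (some v) none).exists_entering
    (R := {x | ∀ v, x = some v → f v ≠ 0}) (by simpa using hv) (by simp)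
  rcases hl with ⟨e, a, b, rfl, rfl, rfl, hl⟩ | ⟨s, hs, rfl, ⟨rfl, rfl⟩ | ⟨rfl, rfl⟩⟩
  · simp at hx hy
    exact hE e b a hl.symm hy hx
  · simp at hx
  · simp at hx
    exact hS s hs hx

/-! ### The greedy growth and its optimality -/

variable [DecidableEq α] [DecidableEq β]

/-- The states of a greedy growth of disjoint trees that are rooted in `S`: there are `k` trees so
far, and `f` and `g` map the vertices and edges of the `l`-th tree to `l` and all others to `0`. In
every step the heaviest possible edge is added, where opening a new tree has weight `0`. -/
inductive Grown (G : Graph α β) (S : Set α) (w : β → ℚ) : ℕ → (α → ℕ) → (β → ℕ) → Prop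
  | start : Grown G S w 0 0 0
  | root {k : ℕ} {f : α → ℕ} {g : β → ℕ} {s : α} (h : Grown G S w k f g) (hs : s ∈ S)
      (hfs : f s = 0) (hmax : ∀ e u v, G.IsLink e u v → f u ≠ 0 → f v = 0 → w e ≤ 0) :
      Grown G S w (k + 1) (Function.update f s (k + 1)) g
  | edge {k : ℕ} {f : α → ℕ} {g : β → ℕ} {d : β} {a b : α} (h : Grown G S w k f g)
      (hd : G.IsLink d a b) (ha : f a ≠ 0) (hb : f b = 0)
      (hmax : ∀ e u v, G.IsLink e u v → f u ≠ 0 → f v = 0 → w e ≤ w d)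
      (hmax' : ∀ s ∈ S, f s = 0 → 0 ≤ w d) :
      Grown G S w k (Function.update f b (f a)) (Function.update g d (f a))

namespace Grown

variable {w : β → ℚ} {k : ℕ} {f : α → ℕ} {g : β → ℕ}

/-- By symmetry this covers both ends of `e`. In particular, no labelled edge meets an unlabelled
vertex, so labelling a new vertex cannot break the property. -/
theorem eq_of_isLink (h : G.Grown S w k f g) {e : β} {u v : α} (hl : G.IsLink e u v)
    (he : g e ≠ 0) : f u = g e := by
  induction h generalizing u v with
  | start => simp at he
  | @root k f g s h hs hfs _ ih =>
    have hne : u ≠ s := by rintro rfl; exact he (by rw [← ih hl he, hfs])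
    rw [Function.update_of_ne hne, ih hl he]
  | @edge k f g d a b h hd ha hb _ _ ih =>
    by_cases hed : e = d
    · subst hed
      rw [Function.update_self]
      obtain rfl | rfl := hl.left_eq_or_eq hd
      · rw [Function.update_of_ne (by rintro rfl; exact ha hb)]
      · rw [Function.update_self]
    · rw [Function.update_of_ne hed] at he ⊢
      rw [Function.update_of_ne, ih hl he]
      rintro rfl
      exact he (by rw [← ih hl he, hb])

theorem le (h : G.Grown S w k f g) (v : α) : f v ≤ k := by
  induction h generalizing v with
  | start => simp
  | @root k f g s h hs hfs _ ih =>
    by_cases hv : v = s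
    · subst hv; simp
    · rw [Function.update_of_ne hv]; exact (ih v).trans (Nat.le_succ k)
  | @edge k f g d a b h hd ha hb _ _ ih =>
    by_cases hv : v = b
    · subst hv; simpa using ih a
    · rw [Function.update_of_ne hv]; exact ih v

theorem exists_joined (h : G.Grown S w k f g) {l : ℕ} (hl : l ≠ 0) (hlk : l ≤ k) :
    ∃ s ∈ S, f s = l ∧ ∀ v, f v = l → G.Joined {e | g e = l} s v := by
  induction h with
  | start => omega
  | @root k f g s h hs hfs _ ih =>
    by_cases hk : l = k + 1
    · subst hk
      refine ⟨s, hs, by simp, fun v hv => ?_⟩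
      by_cases hvs : v = s
      · subst hvs; exact .refl
      · rw [Function.update_of_ne hvs] at hv
        have := h.le v
        omega
    · obtain ⟨r, hr, hfr, hj⟩ := ih (by omega)
      have hrs : r ≠ s := by rintro rfl; omega
      refine ⟨r, hr, by rwa [Function.update_of_ne hrs], fun v hv => hj v ?_⟩
      by_cases hvs : v = s
      · subst hvs; simp at hv; omega
      · rwa [Function.update_of_ne hvs] at hv
  | @edge k f g d a b h hd ha hb _ _ ih =>
    obtain ⟨r, hr, hfr, hj⟩ := ih hlk
    have hrb : r ≠ b := by rintro rfl; omega
    have hgd : g d = 0 := by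
      by_contra hg
      exact hg (by rw [← h.eq_of_isLink hd.symm hg, hb])
    have hsub : {e | g e = l} ⊆ {e | Function.update g d (f a) e = l} := by
      intro e he
      have : e ≠ d := by rintro rfl; exact hl (he.symm.trans hgd)
      simpa [this] using he
    refine ⟨r, hr, by rwa [Function.update_of_ne hrb], fun v hv => ?_⟩
    by_cases hvb : v = b
    · subst hvb
      rw [Function.update_self] at hv
      exact ((hj a hv).mono hsub).trans (hd.joined (by simpa using hv))
    · rw [Function.update_of_ne hvb] at hv
      exact (hj v hv).mono hsub

/-- A cycle of labelled edges must use the new edge `d`, by induction, and hence pass through the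
new vertex `b`. The only labelled edge at `b` is `d`, so the two cycle edges at `b` coincide and `d`
is a loop. But its other end `a` was already labelled, unlike `b`. -/
theorem exists_eq_zero (h : G.Grown S w k f g) {n : ℕ} {x : Fin (n + 1) → α}
    {e : Fin (n + 1) → β} (hc : G.IsCyc x e) : ∃ i, g (e i) = 0 := by
  induction h with
  | start => exact ⟨0, rfl⟩
  | root h _ _ _ ih => exact ih
  | @edge k f g d a b h hd ha hb _ _ ih =>
    by_contra! hg
    obtain ⟨hx, he, hl⟩ := hc
    have hother : ∀ i, (x i = b ∨ x (i + 1) = b) → e i = d := by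
      intro i hi
      by_contra hne
      have hgi := hg i
      rw [Function.update_of_ne hne] at hgi
      rcases hi with rfl | rfl
      · exact hgi (by rw [← h.eq_of_isLink (hl i) hgi, hb])
      · exact hgi (by rw [← h.eq_of_isLink (hl i).symm hgi, hb])
    obtain ⟨i, hi⟩ := ih
    have hid : e i = d := by
      by_contra hne
      exact hg i (by rwa [Function.update_of_ne hne])
    have hxb : ∃ j, x j = b := by
      have h1 := hl i
      rw [hid] at h1
      rcases h1.right_eq_or_eq hd with h2 | h2
      · rcases h1.left_eq_or_eq hd with h3 | h3
        · have := h1.right_unique (h3 ▸ hd)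
          exact ⟨_, this⟩
        · exact ⟨_, h3⟩
      · exact ⟨_, h2⟩
    obtain ⟨j, hj⟩ := hxb
    have h1 := hother j (.inl hj)
    have h2 := hother (j - 1) (.inr (by rwa [sub_add_cancel]))
    have h3 : j - 1 = j := he (h2.trans h1.symm)
    have h4 : j + 1 = j := by
      conv_lhs => rw [← h3]
      exact sub_add_cancel j 1
    have h5 := hl j
    rw [h4, hj, h1] at h5
    have hab := hd.left_unique h5
    rw [hab] at ha
    exact ha hb

/-- The growth is Prim's algorithm in the rooted graph: opening a tree at `s` means adding the edge
from `none` to `s`. The maximality conditions of `Grown` compare the chosen edge with both kinds of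
edges that leave the reached set. -/
theorem exists_isGreedy [Finite α] (h : G.Grown S w k f g) :
    ∃ P : Finset (β ⊕ α), (∀ e, .inl e ∈ P ↔ g e ≠ 0) ∧
      (G.rooted S).IsGreedy (Sum.elim w fun _ => 0) {x | ∀ v, x = some v → f v ≠ 0} P := by
  induction h with
  | start =>
    refine ⟨∅, by simp, ?_⟩
    convert IsGreedy.singleton (G.rooted S) _ none
    ext x
    cases x <;> simp
  | @root k f g s h hs hfs hmax ih =>
    obtain ⟨P, hP, hG⟩ := ih
    refine ⟨insert (.inr s) P, by simpa using hP, ?_⟩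
    convert hG.insert (rooted_isLink_none hs) (by simp) (by simpa using hfs) ?_ using 1
    · ext x
      cases x with
      | none => simp
      | some v =>
        by_cases hv : v = s
        · subst hv; simp
        · simp [hv]
    · rintro _ x y (⟨e, u, v, rfl, rfl, rfl, hl⟩ | ⟨s', hs', rfl, -⟩) hx hy
      · simp at hx hy
        simpa using hmax e u v hl hx hy
      · simp
  | @edge k f g d a b h hd ha hb hmax hmax' ih =>
    obtain ⟨P, hP, hG⟩ := ih
    refine ⟨insert (.inl d) P, ?_, ?_⟩
    · intro e
      by_cases he : e = d
      · subst he; simpa using ha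
      · simpa [he] using hP e
    convert hG.insert (hd.rooted (S := S)) (by simpa using ha) (by simpa using hb) ?_ using 1
    · ext x
      cases x with
      | none => simp
      | some v =>
        by_cases hv : v = b
        · subst hv; simpa using ha
        · simp [hv]
    · rintro _ x y (⟨e, u, v, rfl, rfl, rfl, hl⟩ | ⟨s', hs', rfl, ⟨rfl, rfl⟩ | ⟨rfl, rfl⟩⟩) hx hy
      · simp at hx hy
        simpa using hmax e u v hl hx hy
      · simp at hy
        simpa using hmax' s' hs' hy
      · simp at hy

/-- The tree with label `l + 1`. -/
def tree (h : G.Grown S w k f g) (l : ℕ) : Graph α β where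
  vertexSet := {v | f v = l + 1}
  edgeSet := {e | e ∈ E(G) ∧ g e = l + 1}
  IsLink e x y := G.IsLink e x y ∧ g e = l + 1
  isLink_symm := fun _ _ => ⟨fun _ _ hl => ⟨hl.1.symm, hl.2⟩⟩
  eq_or_eq_of_isLink_of_isLink := fun _ _ _ _ _ h h' => h.1.left_eq_or_eq h'.1
  edge_mem_iff_exists_isLink := by
    intro e
    simp only [edge_mem_iff_exists_isLink, Set.mem_ofPred_eq]
    tauto
  left_mem_of_isLink := fun e x y hl => by
    have := h.eq_of_isLink hl.1 (by omega)
    exact this.trans hl.2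

theorem isSTreePacking (h : G.Grown S w k f g) (hV : V(G) = Set.univ) (hf : ∀ v, f v ≠ 0) :
    G.IsSTreePacking S fun i : Fin k => h.tree i where
  le i := ⟨by simp [hV], fun _ _ _ hl => hl.1⟩
  isTree i := by
    obtain ⟨s, hs, hfs, hj⟩ := h.exists_joined (l := i + 1) (by omega) (by omega)
    have key : ∀ {x y}, G.Joined {e | g e = i + 1} x y →
        Relation.ReflTransGen (h.tree i).Adj x y := fun hxy =>
      Relation.ReflTransGen.mono (fun _ _ ⟨e, he, hl⟩ => ⟨e, hl, he⟩) _ _ hxy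
    refine ⟨⟨⟨s, hfs⟩, fun x hx y hy => key ((hj x hx).symm.trans (hj y hy))⟩, fun n x e hc => ?_⟩
    obtain ⟨j, hj⟩ := h.exists_eq_zero ⟨hc.1, hc.2.1, fun j => (hc.2.2 j).1⟩
    have := (hc.2.2 j).2
    omega
  meets i := by
    obtain ⟨s, hs, hfs, -⟩ := h.exists_joined (l := i + 1) (by omega) (by omega)
    exact ⟨s, hfs, hs⟩
  disjoint i j hij := by
    rw [Set.disjoint_left]
    intro v (hv : f v = i + 1) (hv' : f v = j + 1)
    exact hij (Fin.ext (by omega))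
  spanning := by
    rw [hV, Set.eq_univ_iff_forall]
    intro v
    have := h.le v
    have := hf v
    exact Set.mem_iUnion.2 ⟨⟨f v - 1, by omega⟩, by simp [tree]; omega⟩

/-- Edges at `none` weigh nothing, so the weight of the greedy spanning tree is that of its labelled
edges, which are partitioned among the trees. -/
theorem isMaxSTreePacking [Fintype α] [Fintype β] (h : G.Grown S w k f g) (hV : V(G) = Set.univ)
    (hE : E(G) = Set.univ) (hf : ∀ v, f v ≠ 0) :
    G.IsMaxSTreePacking S w fun i : Fin k => h.tree i := by
  classical
  refine ⟨h.isSTreePacking hV hf, fun l U hU => ?_⟩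
  obtain ⟨F, hF, hcard, hsum⟩ := hU.exists_joined hV w
  obtain ⟨P, hP, hG⟩ := h.exists_isGreedy
  have huniv : {x : Option α | ∀ v, x = some v → f v ≠ 0} = Set.univ :=
    Set.eq_univ_of_forall fun x v _ => hf v
  rw [huniv] at hG
  rw [← hsum]
  refine (hG.sum_le hF hcard).trans_eq ?_
  have hP' : P = P.toLeft.disjSum P.toRight := P.toLeft_disjSum_toRight.symm
  rw [hP', Finset.sum_disjSum]
  simp only [Sum.elim_inl, Sum.elim_inr, Finset.sum_const_zero, add_zero, packingWeight]
  rw [← Finset.sum_biUnion]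
  · refine Finset.sum_congr ?_ fun _ _ => rfl
    ext e
    simp only [Finset.mem_toLeft, hP, Finset.mem_biUnion, Finset.mem_univ, true_and,
      Finset.mem_filter, tree, Set.mem_ofPred_eq, hE]
    constructor
    · intro he
      obtain ⟨x, y, hl⟩ := exists_isLink_of_mem_edgeSet (hE ▸ Set.mem_univ e : e ∈ E(G))
      have h1 := h.eq_of_isLink hl he
      have h2 := h.le x
      exact ⟨⟨g e - 1, by omega⟩, by simp; omega⟩
    · rintro ⟨i, hi⟩
      omega
  · intro i _ j _ hij
    rw [Function.onFun, Finset.disjoint_left]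
    intro e he he'
    have h1 : g e = i + 1 := (Finset.mem_filter.1 he).2.2
    have h2 : g e = j + 1 := (Finset.mem_filter.1 he').2.2
    exact hij (Fin.ext (by omega))

end Grown

end Graph

/-! ### Reading list entries, and polynomial time from structured programs -/

theorem List.getElem?_flatMap_of_length_eq {γ δ : Type*} {F : γ → List δ} {c : ℕ}
    (hF : ∀ x, (F x).length = c) (l : List γ) (i j : ℕ) (hi : i < l.length) (hj : j < c) :
    (l.flatMap F)[c * i + j]? = (F l[i])[j]? := by
  induction l generalizing i with
  | nil => simp at hi
  | cons x l ih =>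
    rw [List.flatMap_cons]
    cases i with
    | zero => rw [List.getElem?_append_left (by simpa [hF] using hj)]; simp
    | succ i =>
      rw [List.getElem?_append_right (by rw [hF, mul_add]; omega)]
      have : c * (i + 1) + j - (F x).length = c * i + j := by rw [hF, mul_add]; omega
      rw [this, ih i (by simpa using hi)]
      simp

theorem List.getD_eq_of_getElem? {γ : Type*} {l : List γ} {i : ℕ} {d x : γ} (h : l[i]? = some x) :
    l.getD i d = x := by
  rw [List.getD_eq_getElem?_getD, h, Option.getD_some]

namespace RAM

theorem size_lt_bitSize {l : List ℕ} {x : ℕ} (h : x ∈ l) : Nat.size x < bitSize l :=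
  Nat.lt_of_succ_le (List.le_sum_of_mem (List.mem_map.2 ⟨x, h, rfl⟩))

theorem length_le_bitSize (l : List ℕ) : l.length ≤ bitSize l := by
  induction l with
  | nil => simp
  | cons x l ih => simp only [bitSize, List.map_cons, List.sum_cons, List.length_cons] at *; omega

theorem input_bitsLE (l : List ℕ) : (input l).BitsLE (bitSize l) := by
  intro a i
  unfold input
  split
  · cases i with
    | zero => exact (Nat.size_le_self _).trans (length_le_bitSize l)
    | succ i =>
      rw [List.getD_cons_succ, List.getD_eq_getElem?_getD]
      cases h : l[i]? with
      | none => simp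
      | some x => exact (size_lt_bitSize (List.mem_of_getElem? h)).le
  · simp

/-- A well-formed structured program shows that a problem is solvable in polynomial time. -/
theorem SolvableInPolyTime.of_code {α : Type} {enc : α → List ℕ} {IsSolution : α → List ℕ → Prop}
    (c : Code) (hc : c.WF) (h1 : ∀ x, input (enc x) 0 1 ≤ bitSize (enc x))
    (h2 : ∀ x, input (enc x) 0 2 ≤ bitSize (enc x))
    (h : ∀ x, IsSolution x (output (c.run (input (enc x))))) :
    SolvableInPolyTime enc IsSolution := by
  refine ⟨c.toProg, c.time * (Polynomial.X + 1), fun x => ?_⟩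
  obtain ⟨-, t, ht, he⟩ := hc.exec (N := bitSize (enc x)) (input (enc x)) (bitSize (enc x))
    (h1 x) (h2 x) (input_bitsLE _)
  exact ⟨_, t, he, by simpa using ht, h x⟩

/-- Cell `0` of array `a`. -/
abbrev var (a : ℕ) : Expr := .get a (.lit 0)

/-- Assignment to cell `0` of array `a`. -/
abbrev assign (a : ℕ) (e : Expr) : Code := .store a (.lit 0) e

/-- Consecutive execution. -/
def block : List Code → Code
  | [] => .skip
  | c :: l => .seq c (block l)

end RAM

/-! ### Rational weights and the input encoding -/

namespace STreeInstance

open RAM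

/-- The number with sign `s`, absolute value of the numerator `x`, and denominator `d`. -/
def ratOf (s x d : ℕ) : ℚ := (if s = 0 then (x : ℚ) else -x) / d

/-- After cross-multiplication, negative terms change sides, so that only natural numbers occur. The
truncated difference is nonzero exactly if the inequality is strict. This is the test in `better`.
-/
theorem ratOf_lt_iff {s x d s' x' d' : ℕ} (hs : s ≤ 1) (hs' : s' ≤ 1) (hd : d ≠ 0)
    (hd' : d' ≠ 0) : ratOf s' x' d' < ratOf s x d ↔
      ((1 - s) * x * d' + s' * x' * d) - (s * x * d' + (1 - s') * x' * d) ≠ 0 := by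
  unfold ratOf
  have h1 : (0 : ℚ) < d := by positivity
  have h2 : (0 : ℚ) < d' := by positivity
  rw [div_lt_div_iff₀ h2 h1]
  interval_cases s <;> interval_cases s' <;> simp
  · norm_cast
    omega
  · rw [neg_lt_iff_pos_add]
    norm_cast
    have e1 : x * d = 0 ↔ x = 0 := by simp [hd]
    have e2 : x' * d = 0 ↔ x' = 0 := by simp [hd]
    have e3 : x * d' = 0 ↔ x = 0 := by simp [hd']
    omega
  · have : (0 : ℚ) ≤ x' * d := by positivity
    have : (0 : ℚ) ≤ x * d' := by positivity
    linarith
  · norm_cast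
    omega

theorem ratOf_num_den (q : ℚ) : ratOf (if q < 0 then 1 else 0) q.num.natAbs q.den = q := by
  unfold ratOf
  have h : q = q.num / q.den := (Rat.num_div_den q).symm
  have hc : ((q.num.natAbs : ℕ) : ℚ) = ((|q.num| : ℤ) : ℚ) := by
    rw [← Int.natCast_natAbs]; simp
  rw [hc]
  split_ifs with h1 h2 h2
  · simp at h2
  · rw [abs_of_neg (Rat.num_neg.2 h1)]
    push_cast
    rw [neg_neg]
    exact h.symm
  · rw [abs_of_nonneg (Rat.num_nonneg.2 (not_lt.1 h1))]
    exact h.symm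
  · exact absurd rfl h2

variable (I : STreeInstance)

/-- The input array. -/
abbrev inp : ℕ → ℕ := input I.encode 0

theorem inp_one : I.inp 1 = I.n := rfl

theorem inp_two : I.inp 2 = I.m := rfl

theorem length_encode : I.encode.length = 2 + I.n + 5 * I.m := by
  simp [encode, List.length_flatMap, mul_comm]
  omega

/-- Cell 0 holds the length of the list and cells 1 and 2 hold `n` and `m`, hence the offset 3. -/
theorem inp_vertex (v : Fin I.n) : I.inp (3 + v) = if v ∈ I.S then 1 else 0 := by
  have : 3 + (v : ℕ) = (v + 2) + 1 := by omega
  simp only [inp, input, if_true]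
  rw [this, List.getD_cons_succ]
  apply List.getD_eq_of_getElem?
  rw [encode, List.append_assoc, List.getElem?_append_right (by simp),
    List.getElem?_append_left (by simp)]
  simp

theorem inp_edge (e : Fin I.m) (j : ℕ) (hj : j < 5) : I.inp (3 + I.n + 5 * e + j) =
    [((I.ends e).1 : ℕ), ((I.ends e).2 : ℕ), if I.w e < 0 then 1 else 0,
        (I.w e).num.natAbs, (I.w e).den].getD j 0 := by
  have : 3 + I.n + 5 * e + j = (2 + I.n + (5 * e + j)) + 1 := by omega
  simp only [inp, input, if_true]
  rw [this, List.getD_cons_succ, encode, List.getD_eq_getElem?_getD,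
    List.getElem?_append_right (by simp; omega), List.getD_eq_getElem?_getD]
  congr 1
  have h : 2 + I.n + (5 * e + j) - ([I.n, I.m] ++
      (List.finRange I.n).map (fun v => if v ∈ I.S then 1 else 0)).length = 5 * e + j := by
    simp; omega
  rw [h, List.getElem?_flatMap_of_length_eq (by simp) _ _ _ (by simp) hj]
  simp

theorem isLink_iff {e : Fin I.m} {u v : Fin I.n} : I.graph.IsLink e u v ↔
    (I.ends e).1 = u ∧ (I.ends e).2 = v ∨ (I.ends e).1 = v ∧ (I.ends e).2 = u := by
  simp [graph, Prod.ext_iff]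

theorem edgeSet_graph : I.graph.edgeSet = Set.univ :=
  Set.eq_univ_of_forall fun _ => (Graph.edge_mem_iff_exists_isLink ..).2 ⟨_, _, rfl⟩

/-! ### The algorithm and the selection of a best candidate -/

/-- The label of a vertex. -/
def label (e : Expr) : Expr := .get 1 (.add (.lit 3) e)

/-- The `j`-th entry of the description of the current edge. -/
def edgeEntry (j : ℕ) : Expr :=
  .get 0 (.add (.add (.add (.lit 3) (.get 0 (.lit 1))) (.mul (.lit 5) (var 2))) (.lit j))

/-- Whether there is no best candidate so far or the current candidate is better. -/
def better : Expr :=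
  .add (.sub (.lit 1) (var 4))
    (.sub (.add (.mul (.mul (.sub (.lit 1) (var 14)) (var 15)) (var 10))
        (.mul (.mul (var 8) (var 9)) (var 16)))
      (.add (.mul (.mul (var 14) (var 15)) (var 10))
        (.mul (.mul (.sub (.lit 1) (var 8)) (var 9)) (var 16))))

/-- Compare a candidate, which consists of a new vertex, an edge, a label, and a weight, with the
best candidate so far. -/
def offer (v e l s x d : Expr) : Code :=
  block [assign 11 v, assign 12 e, assign 13 l, assign 14 s, assign 15 x, assign 16 d,
    .branch better (block [assign 4 (.lit 1), assign 5 (var 11), assign 6 (var 12),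
      assign 7 (var 13), assign 8 (var 14), assign 9 (var 15), assign 10 (var 16)]) .skip]

/-- Offer the current edge for an extension from its `a`-th to its `b`-th end. -/
def offerArc (a b : ℕ) : Code :=
  .branch (label (edgeEntry a))
    (.branch (label (edgeEntry b)) .skip
      (offer (edgeEntry b) (var 2) (label (edgeEntry a)) (edgeEntry 2) (edgeEntry 3) (edgeEntry 4)))
    .skip

/-- Offer the current vertex as the root of a new tree. -/
def offerRoot : Code :=
  .branch (.get 0 (.add (.lit 3) (var 2)))
    (.branch (label (var 2)) .skip
      (offer (var 2) (.get 0 (.lit 2)) (.add (.get 1 (.lit 2)) (.lit 1)) (.lit 0) (.lit 0) (.lit 1)))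
    .skip

/-- Execute the best candidate. -/
def commit : Code :=
  .branch (var 4)
    (block [.store 1 (.add (.lit 3) (var 5)) (var 7),
      .store 1 (.add (.add (.lit 3) (.get 0 (.lit 1))) (var 6)) (var 7),
      .store 1 (.lit 2) (.add (.get 1 (.lit 2)) (.sub (var 7) (.get 1 (.lit 2))))])
    .skip

/-- One step of the greedy algorithm. -/
def round : Code :=
  block [assign 4 (.lit 0), .count 2 1 offerRoot, .count 2 2 (.seq (offerArc 0 1) (offerArc 1 0)),
    commit]

/-- The greedy algorithm. -/
def algorithm : Code :=
  block [.count 3 1 round, .count 2 1 (.branch (label (var 2)) .skip (assign 17 (.lit 1))),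
    .branch (var 17) (block [.store 1 (.lit 0) (.lit 1), .store 1 (.lit 1) (.lit 0)])
      (block [.store 1 (.lit 0) (.add (.add (.get 0 (.lit 1)) (.get 0 (.lit 2))) (.lit 2)),
        .store 1 (.lit 1) (.lit 1)])]

/-- Products occur only in the branch condition `better` and in the addresses of `edgeEntry`. -/
theorem wf_algorithm : algorithm.WF := by
  simp [algorithm, round, commit, offerRoot, offerArc, offer, block, Code.WF, Code.writes,
    Expr.MulFree, edgeEntry, label]

/-- Arrays `5` to `10` hold a candidate of maximum weight among those in `C`, if any. -/
def Best (σ : Mem) (C : ℕ → ℕ → ℕ → ℚ → Prop) : Prop :=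
  (σ 4 0 = 0 ∧ ∀ v e l q, ¬ C v e l q) ∨
    (σ 4 0 = 1 ∧ σ 8 0 ≤ 1 ∧ σ 10 0 ≠ 0 ∧
      C (σ 5 0) (σ 6 0) (σ 7 0) (ratOf (σ 8 0) (σ 9 0) (σ 10 0)) ∧
      ∀ v e l q, C v e l q → q ≤ ratOf (σ 8 0) (σ 9 0) (σ 10 0))

theorem Best.congr {σ τ : Mem} {C D : ℕ → ℕ → ℕ → ℚ → Prop} (h : Best σ C)
    (hτ : ∀ a, 4 ≤ a → a ≤ 10 → τ a = σ a) (hCD : ∀ v e l q, C v e l q ↔ D v e l q) :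
    Best τ D := by
  obtain rfl : C = D := by
    funext v e l q
    exact propext (hCD v e l q)
  unfold Best
  rw [hτ 4, hτ 5, hτ 6, hτ 7, hτ 8, hτ 9, hτ 10] <;> first | exact h | omega

/-- The six expressions are evaluated one after the other, each in the memory changed by the
previous assignments; hence the nested writes in the hypotheses. -/
theorem Best.offer {σ : Mem} {C : ℕ → ℕ → ℕ → ℚ → Prop} (h : Best σ C) {v e l s x d : Expr}
    {v' e' l' s' x' d' : ℕ} (hv : v.eval σ = v')
    (he : e.eval (σ.write 11 0 v') = e')
    (hl : l.eval ((σ.write 11 0 v').write 12 0 e') = l')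
    (hs : s.eval (((σ.write 11 0 v').write 12 0 e').write 13 0 l') = s')
    (hx : x.eval ((((σ.write 11 0 v').write 12 0 e').write 13 0 l').write 14 0 s') = x')
    (hd : d.eval (((((σ.write 11 0 v').write 12 0 e').write 13 0 l').write 14 0 s').write 15 0 x')
      = d') (hs1 : s' ≤ 1) (hd0 : d' ≠ 0) :
    Best ((STreeInstance.offer v e l s x d).run σ) fun v₁ e₁ l₁ q₁ =>
      C v₁ e₁ l₁ q₁ ∨ v₁ = v' ∧ e₁ = e' ∧ l₁ = l' ∧ q₁ = ratOf s' x' d' := by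
  have h0 : ∀ τ : Mem, (Expr.lit 0).eval τ = 0 := fun _ => rfl
  simp only [STreeInstance.offer, block, Code.run, h0, hv, he, hl, hs, hx, hd]
  set τ := (((((σ.write 11 0 v').write 12 0 e').write 13 0 l').write 14 0 s').write 15 0 x').write
    16 0 d' with hτ
  have t : ∀ a, a ≤ 10 → τ a = σ a := by
    intro a ha
    simp only [hτ]
    repeat rw [Mem.write_of_ne (by omega)]
  have t11 : τ 11 0 = v' := by simp [hτ, Mem.write_apply]
  have t12 : τ 12 0 = e' := by simp [hτ, Mem.write_apply]
  have t13 : τ 13 0 = l' := by simp [hτ, Mem.write_apply]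
  have t14 : τ 14 0 = s' := by simp [hτ, Mem.write_apply]
  have t15 : τ 15 0 = x' := by simp [hτ, Mem.write_apply]
  have t16 : τ 16 0 = d' := by simp [hτ, Mem.write_apply]
  clear_value τ
  have hb : better.eval τ = (1 - σ 4 0) + (((1 - s') * x' * σ 10 0 + σ 8 0 * σ 9 0 * d') -
      (s' * x' * σ 10 0 + (1 - σ 8 0) * σ 9 0 * d')) := by
    simp [better, Expr.eval, t, t14, t15, t16]
  rw [hb]
  split_ifs with hlt
  · right
    simp only [Mem.write_apply, Expr.eval, t11, t12, t13, t14, t15, t16]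
    refine ⟨by simp, by simpa using hs1, by simpa using hd0, .inr (by simp), ?_⟩
    norm_num only [and_true, if_true, if_false]
    rintro v₁ e₁ l₁ q₁ (hC | ⟨-, -, -, rfl⟩)
    · rcases h with ⟨-, h⟩ | ⟨h4, h8, h10, -, h⟩
      · exact absurd hC (h _ _ _ _)
      · rw [h4, Nat.sub_self, zero_add, ← ratOf_lt_iff hs1 h8 hd0 h10] at hlt
        exact (h _ _ _ _ hC).trans hlt.le
    · rfl
  · rcases h with ⟨h4, h⟩ | ⟨h4, h8, h10, hC, h⟩
    · rw [h4] at hlt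
      omega
    · right
      rw [h4, Nat.sub_self, zero_add, ← ratOf_lt_iff hs1 h8 hd0 h10, not_lt] at hlt
      simp only [t _ (by norm_num : 4 ≤ 10), t _ (by norm_num : 5 ≤ 10),
        t _ (by norm_num : 6 ≤ 10), t _ (by norm_num : 7 ≤ 10), t _ (by norm_num : 8 ≤ 10),
        t _ (by norm_num : 9 ≤ 10), t _ (le_refl 10)]
      refine ⟨h4, h8, h10, .inl hC, ?_⟩
      rintro v₁ e₁ l₁ q₁ (hC | ⟨-, -, -, rfl⟩)
      · exact h _ _ _ _ hC
      · exact hlt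

end STreeInstance

/-! ### Correctness of the algorithm -/

namespace STreeInstance

open RAM

variable (I : STreeInstance)

/-- The array `μ` holds the state of the greedy algorithm. -/
structure Holds (μ : ℕ → ℕ) (k : ℕ) (f : Fin I.n → ℕ) (g : Fin I.m → ℕ) : Prop where
  count : μ 2 = k
  vertex : ∀ v : Fin I.n, μ (3 + v) = f v
  edge : ∀ e : Fin I.m, μ (3 + I.n + e) = g e

/-- The candidates for new roots, from vertex `i` on. -/
def RootCand (k : ℕ) (f : Fin I.n → ℕ) (i v e l : ℕ) (q : ℚ) : Prop :=
  ∃ s : Fin I.n, i ≤ s ∧ s ∈ I.S ∧ f s = 0 ∧ v = s ∧ e = I.m ∧ l = k + 1 ∧ q = 0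

/-- The candidates for extensions of trees, from edge `i` on. -/
def EdgeCand (f : Fin I.n → ℕ) (i v e l : ℕ) (q : ℚ) : Prop :=
  ∃ (d : Fin I.m) (a b : Fin I.n), i ≤ d ∧ I.graph.IsLink d a b ∧ f a ≠ 0 ∧ f b = 0 ∧
    v = b ∧ e = d ∧ l = f a ∧ q = I.w d

variable {I} {k : ℕ} {f : Fin I.n → ℕ} {g : Fin I.m → ℕ}

/-- The counter runs downwards, so the loop invariant is that the candidates with index at least `i`
have been offered. -/
theorem best_count_offerRoot {σ : Mem} (h0 : σ 0 = I.inp) (h1 : I.Holds (σ 1) k f g)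
    (hB : Best σ fun _ _ _ _ => False) :
    Best ((Code.count 2 1 offerRoot).run σ) (I.RootCand k f 0) := by
  have hn : σ 0 1 = I.n := by rw [h0, inp_one]
  simp only [Code.run]
  rw [hn]
  refine (countdown_induction (fun i τ => τ 0 = I.inp ∧ τ 1 = σ 1 ∧ Best τ (I.RootCand k f i))
    ?_ ⟨?_, ?_, ?_⟩).2.2
  · rintro i hi τ ⟨t0, t1, tB⟩
    have w0 : 0 ∉ offerRoot.writes := by simp [offerRoot, offer, block, Code.writes]
    have w1 : 1 ∉ offerRoot.writes := by simp [offerRoot, offer, block, Code.writes]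
    refine ⟨by rw [Code.run_of_notMem_writes _ w0, Mem.write_of_ne (by simp), t0],
      by rw [Code.run_of_notMem_writes _ w1, Mem.write_of_ne (by simp), t1], ?_⟩
    set ρ := τ.write 2 0 i with hρ
    have r0 : ρ 0 = I.inp := by rw [hρ, Mem.write_of_ne (by simp), t0]
    have r1 : ρ 1 = σ 1 := by rw [hρ, Mem.write_of_ne (by simp), t1]
    have r2 : ρ 2 0 = i := by simp [hρ, Mem.write_apply]
    have rB : Best ρ (I.RootCand k f (i + 1)) :=
      tB.congr (fun a h _ => Mem.write_of_ne (by omega)) fun _ _ _ _ => Iff.rfl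
    clear_value ρ
    let s : Fin I.n := ⟨i, hi⟩
    have hin := I.inp_vertex s
    have hf := h1.vertex s
    simp only [s] at hin hf
    have hsplit : ∀ v e l q, I.RootCand k f i v e l q ↔ I.RootCand k f (i + 1) v e l q ∨
        s ∈ I.S ∧ f s = 0 ∧ v = i ∧ e = I.m ∧ l = k + 1 ∧ q = 0 := by
      intro v e l q
      constructor
      · rintro ⟨r, hr, hrS, hfr, rfl, hrest⟩
        rcases hr.eq_or_lt with h | h
        · obtain rfl : s = r := Fin.ext h
          exact .inr ⟨hrS, hfr, rfl, hrest⟩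
        · exact .inl ⟨r, h, hrS, hfr, rfl, hrest⟩
      · rintro (⟨r, hr, hrest⟩ | ⟨hrS, hfr, rfl, hrest⟩)
        · exact ⟨r, by omega, hrest⟩
        · exact ⟨s, le_rfl, hrS, hfr, rfl, hrest⟩
    simp only [offerRoot, Code.run, Expr.eval, label, r0, r1, r2, hin, hf]
    by_cases hS : (⟨i, hi⟩ : Fin I.n) ∈ I.S
    · rw [if_pos hS, if_pos one_ne_zero]
      split_ifs with hfs
      · exact rB.congr (fun _ _ _ => rfl) fun v e l q => by rw [hsplit]; tauto
      · refine (rB.offer (v' := i) (e' := I.m) (l' := k + 1) (s' := 0) (x' := 0) (d' := 1)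
          ?_ ?_ ?_ rfl rfl rfl (by simp) (by simp)).congr (fun _ _ _ => rfl) fun v e l q => ?_
        · simp [Expr.eval, r2]
        · simp [Expr.eval, Mem.write_apply, r0, inp_two]
        · simp [Expr.eval, Mem.write_apply, r1, h1.count]
        · rw [hsplit]
          simp only [ratOf, if_true, Nat.cast_zero, zero_div]
          tauto
    · rw [if_neg hS, if_neg (by simp)]
      exact rB.congr (fun _ _ _ => rfl) fun v e l q => by rw [hsplit]; tauto
  · rw [Mem.write_of_ne (by simp), h0]
  · rw [Mem.write_of_ne (by simp)]
  · refine hB.congr (fun a h _ => Mem.write_of_ne (by omega)) fun v e l q => ?_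
    simp only [false_iff]
    rintro ⟨s, hs, -⟩
    omega

theorem Best.offerArc {σ : Mem} {C : ℕ → ℕ → ℕ → ℚ → Prop} (hB : Best σ C) (h0 : σ 0 = I.inp)
    (h1 : I.Holds (σ 1) k f g) {d : Fin I.m} (h2 : σ 2 0 = d) {a b : ℕ} {u v : Fin I.n}
    (ha : I.inp (3 + I.n + 5 * d + a) = u) (hb : I.inp (3 + I.n + 5 * d + b) = v) :
    Best ((STreeInstance.offerArc a b).run σ) fun v₁ e₁ l₁ q₁ => C v₁ e₁ l₁ q₁ ∨
      f u ≠ 0 ∧ f v = 0 ∧ v₁ = v ∧ e₁ = d ∧ l₁ = f u ∧ q₁ = I.w d := by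
  have entry : ∀ (j : ℕ) (τ : Mem), τ 0 = σ 0 → τ 2 = σ 2 →
      (edgeEntry j).eval τ = I.inp (3 + I.n + 5 * d + j) := by
    intro j τ t0 t2
    simp [edgeEntry, Expr.eval, t0, t2, h2, h0, inp_one]
  have e2 := I.inp_edge d 2 (by norm_num)
  have e3 := I.inp_edge d 3 (by norm_num)
  have e4 := I.inp_edge d 4 (by norm_num)
  simp only [List.getD_cons_succ, List.getD_cons_zero] at e2 e3 e4
  simp only [STreeInstance.offerArc, Code.run, label, Expr.eval, entry _ σ rfl rfl, ha, hb,
    h1.vertex]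
  split_ifs with hu hv
  · exact hB.congr (fun _ _ _ => rfl) fun _ _ _ _ => by tauto
  · refine (hB.offer (v' := v) (e' := d) (l' := f u) (s' := if I.w d < 0 then 1 else 0)
      (x' := (I.w d).num.natAbs) (d' := (I.w d).den) ?_ ?_ ?_ ?_ ?_ ?_ ?_ ?_).congr
      (fun _ _ _ => rfl) fun _ _ _ _ => ?_
    · rw [entry _ σ rfl rfl, hb]
    · simp [Expr.eval, Mem.write_apply, h2]
    · simp only [Expr.eval]
      rw [entry, ha] <;> repeat rw [Mem.write_of_ne (by simp)]
      exact h1.vertex u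
    · rw [entry, e2] <;> repeat rw [Mem.write_of_ne (by simp)]
    · rw [entry, e3] <;> repeat rw [Mem.write_of_ne (by simp)]
    · rw [entry, e4] <;> repeat rw [Mem.write_of_ne (by simp)]
    · split_ifs <;> simp
    · exact (I.w d).den_nz
    · rw [ratOf_num_den]
      tauto
  · exact hB.congr (fun _ _ _ => rfl) fun _ _ _ _ => by tauto

theorem best_count_offerArc {σ : Mem} {C : ℕ → ℕ → ℕ → ℚ → Prop} (h0 : σ 0 = I.inp)
    (h1 : I.Holds (σ 1) k f g) (hB : Best σ C) :
    Best ((Code.count 2 2 (.seq (offerArc 0 1) (offerArc 1 0))).run σ)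
      fun v e l q => C v e l q ∨ I.EdgeCand f 0 v e l q := by
  have hm : σ 0 2 = I.m := by rw [h0, inp_two]
  simp only [Code.run]
  rw [hm]
  refine (countdown_induction (fun i τ => τ 0 = I.inp ∧ τ 1 = σ 1 ∧
    Best τ fun v e l q => C v e l q ∨ I.EdgeCand f i v e l q) ?_ ⟨?_, ?_, ?_⟩).2.2
  · rintro i hi τ ⟨t0, t1, tB⟩
    have hw : ∀ a b c, c ≤ 2 → c ∉ (offerArc a b).writes := by
      intro a b c hc
      simp [offerArc, offer, block, Code.writes]
      omega
    refine ⟨by rw [Code.run_of_notMem_writes _ (hw _ _ _ (by simp)),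
        Code.run_of_notMem_writes _ (hw _ _ _ (by simp)), Mem.write_of_ne (by simp), t0],
      by rw [Code.run_of_notMem_writes _ (hw _ _ _ (by simp)),
        Code.run_of_notMem_writes _ (hw _ _ _ (by simp)), Mem.write_of_ne (by simp), t1], ?_⟩
    set ρ := τ.write 2 0 i with hρ
    have r0 : ρ 0 = I.inp := by rw [hρ, Mem.write_of_ne (by simp), t0]
    have r1 : ρ 1 = σ 1 := by rw [hρ, Mem.write_of_ne (by simp), t1]
    have r2 : ρ 2 0 = i := by simp [hρ, Mem.write_apply]
    have rB : Best ρ (fun v e l q => C v e l q ∨ I.EdgeCand f (i + 1) v e l q) :=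
      tB.congr (fun a h _ => Mem.write_of_ne (by omega)) fun _ _ _ _ => Iff.rfl
    clear_value ρ
    let d : Fin I.m := ⟨i, hi⟩
    have e0 := I.inp_edge d 0 (by norm_num)
    have e1 := I.inp_edge d 1 (by norm_num)
    simp only [List.getD_cons_succ, List.getD_cons_zero] at e0 e1
    have hrun : ∀ c, c ≤ 2 → (offerArc 0 1).run ρ c = ρ c := fun c hc =>
      Code.run_of_notMem_writes _ (hw _ _ _ hc) _
    have b1 := rB.offerArc r0 (r1.symm ▸ h1) (d := d) r2 e0 e1
    have b2 := b1.offerArc ((hrun 0 (by simp)).trans r0)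
      (((hrun 1 (by simp)).trans r1).symm ▸ h1) (d := d)
      ((congrFun (hrun 2 (by simp)) 0).trans r2) e1 e0
    refine b2.congr (fun _ _ _ => rfl) fun v e l q => ?_
    constructor
    · rintro (((hC | ⟨d', a, b, hd, hrest⟩) | ⟨hu, hv, rfl, rfl, rfl, rfl⟩) |
        ⟨hu, hv, rfl, rfl, rfl, rfl⟩)
      · exact .inl hC
      · exact .inr ⟨d', a, b, by omega, hrest⟩
      · exact .inr ⟨d, _, _, le_rfl, (I.isLink_iff).2 (.inl ⟨rfl, rfl⟩), hu, hv, rfl, rfl, rfl, rfl⟩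
      · exact .inr ⟨d, _, _, le_rfl, (I.isLink_iff).2 (.inr ⟨rfl, rfl⟩), hu, hv, rfl, rfl, rfl, rfl⟩
    · rintro (hC | ⟨d', a, b, hd, hl, ha, hb, rfl, rfl, rfl, rfl⟩)
      · exact .inl (.inl (.inl hC))
      · rcases hd.eq_or_lt with h | h
        · obtain rfl : d = d' := Fin.ext h
          rcases I.isLink_iff.1 hl with ⟨rfl, rfl⟩ | ⟨rfl, rfl⟩
          · exact .inl (.inr ⟨ha, hb, rfl, rfl, rfl, rfl⟩)
          · exact .inr ⟨ha, hb, rfl, rfl, rfl, rfl⟩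
        · exact .inl (.inl (.inr ⟨d', a, b, h, hl, ha, hb, rfl, rfl, rfl, rfl⟩))
  · rw [Mem.write_of_ne (by simp), h0]
  · rw [Mem.write_of_ne (by simp)]
  · refine hB.congr (fun a h _ => Mem.write_of_ne (by omega)) fun v e l q => ?_
    refine ⟨.inl, ?_⟩
    rintro (hC | ⟨d, _, _, hd, -⟩)
    · exact hC
    · omega

/-- No candidate is left. -/
def Stuck (I : STreeInstance) (f : Fin I.n → ℕ) : Prop :=
  (∀ s ∈ I.S, f s ≠ 0) ∧ ∀ e u v, I.graph.IsLink e u v → f u ≠ 0 → f v ≠ 0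

theorem card_update {f : Fin I.n → ℕ} {b : Fin I.n} {l : ℕ} (hb : f b = 0) (hl : l ≠ 0) :
    ({v | Function.update f b l v ≠ 0} : Finset (Fin I.n)).card
      = ({v | f v ≠ 0} : Finset (Fin I.n)).card + 1 := by
  rw [← Finset.card_insert_of_notMem (a := b) (by simp [hb])]
  congr 1
  ext v
  by_cases hv : v = b
  · subst hv; simp [hl]
  · simp [hv]

/-- Without a candidate the state is unchanged and stuck. Otherwise the best candidate, being at
least as heavy as all edges and roots on offer, satisfies the maximality conditions of one
constructor of `Grown`. -/
theorem run_round {σ : Mem} (h0 : σ 0 = I.inp) (h1 : I.Holds (σ 1) k f g)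
    (hG : I.graph.Grown (I.S : Set (Fin I.n)) I.w k f g) :
    ∃ k' f' g', I.Holds (round.run σ 1) k' f' g' ∧
      I.graph.Grown (I.S : Set (Fin I.n)) I.w k' f' g' ∧
      (I.Stuck f' ∨ ¬ I.Stuck f ∧ ({v | f' v ≠ 0} : Finset (Fin I.n)).card
        = ({v | f v ≠ 0} : Finset (Fin I.n)).card + 1) := by
  have w0 : ∀ c, c ≤ 1 → c ∉ (Code.count 2 1 offerRoot).writes := by
    intro c hc
    simp [offerRoot, offer, block, Code.writes]
    omega
  have w1 : ∀ c, c ≤ 1 → c ∉ (Code.count 2 2 (.seq (offerArc 0 1) (offerArc 1 0))).writes := by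
    intro c hc
    simp [offerArc, offer, block, Code.writes]
    omega
  set σ₁ := (assign 4 (.lit 0)).run σ with hσ₁
  have b1 : Best σ₁ fun _ _ _ _ => False :=
    .inl ⟨by simp [hσ₁, Code.run, Expr.eval, Mem.write_apply], by simp⟩
  have s1 : ∀ c, c ≤ 1 → σ₁ c = σ c := fun c hc =>
    Code.run_of_notMem_writes _ (by simp [Code.writes]; omega) _
  set σ₂ := (Code.count 2 1 offerRoot).run σ₁ with hσ₂
  have s2 : ∀ c, c ≤ 1 → σ₂ c = σ c := fun c hc =>
    (Code.run_of_notMem_writes _ (w0 c hc) _).trans (s1 c hc)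
  have b2 : Best σ₂ (I.RootCand k f 0) := best_count_offerRoot ((s1 0 (by simp)).trans h0)
    ((s1 1 (by simp)).symm ▸ h1) b1
  set σ₃ := (Code.count 2 2 (.seq (offerArc 0 1) (offerArc 1 0))).run σ₂ with hσ₃
  have s3 : ∀ c, c ≤ 1 → σ₃ c = σ c := fun c hc =>
    (Code.run_of_notMem_writes _ (w1 c hc) _).trans (s2 c hc)
  have b3 := best_count_offerArc (g := g) ((s2 0 (by simp)).trans h0) ((s2 1 (by simp)).symm ▸ h1) b2
  have hr : round.run σ = commit.run σ₃ := rfl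
  rw [hr]
  have t0 := (s3 0 (by simp)).trans h0
  have t1 := s3 1 (by simp)
  rw [← hσ₃] at b3
  clear_value σ₁ σ₂ σ₃
  rw [← t1] at h1
  rcases b3 with ⟨h4, hC⟩ | ⟨h4, -, -, hC, hmax⟩
  · have hrun : commit.run σ₃ = σ₃ := by simp [commit, Code.run, Expr.eval, h4]
    rw [hrun]
    refine ⟨k, f, g, h1, hG, .inl ⟨fun s hs hfs => ?_, fun e u v hl hu hv => ?_⟩⟩
    · exact hC s I.m (k + 1) 0 (.inl ⟨s, by simp, hs, hfs, rfl, rfl, rfl, rfl⟩)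
    · exact hC v e (f u) (I.w e) (.inr ⟨e, u, v, by simp, hl, hu, hv, rfl, rfl, rfl, rfl⟩)
  -- The new count `k + (l - k)` is the maximum of `k` and the label `l`: it grows for a new root
  -- and stays for an extension.
  · have hrun : ∀ i, commit.run σ₃ 1 i = if i = 2 then k + (σ₃ 7 0 - k) else
        if i = 3 + I.n + σ₃ 6 0 then σ₃ 7 0 else if i = 3 + σ₃ 5 0 then σ₃ 7 0 else σ₃ 1 i := by
      intro i
      have n1 : 2 ≠ 3 + I.n + σ₃ 6 0 := by omega
      have n2 : 2 ≠ 3 + σ₃ 5 0 := by omega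
      simp [commit, block, Code.run, Expr.eval, h4, Mem.write_apply, t0, inp_one, h1.count, n1, n2]
    have hmaxR : ∀ s ∈ I.S, f s = 0 → 0 ≤ ratOf (σ₃ 8 0) (σ₃ 9 0) (σ₃ 10 0) := fun s hs hfs =>
      hmax s I.m (k + 1) 0 (.inl ⟨s, by simp, hs, hfs, rfl, rfl, rfl, rfl⟩)
    have hmaxE : ∀ e u v, I.graph.IsLink e u v → f u ≠ 0 → f v = 0 →
        I.w e ≤ ratOf (σ₃ 8 0) (σ₃ 9 0) (σ₃ 10 0) := fun e u v hl hu hv =>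
      hmax v e (f u) (I.w e) (.inr ⟨e, u, v, by simp, hl, hu, hv, rfl, rfl, rfl, rfl⟩)
    rcases hC with ⟨s, -, hs, hfs, h5, h6, h7, hq⟩ | ⟨d, a, b, -, hl, ha, hb, h5, h6, h7, hq⟩
    · rw [hq] at hmaxE
      refine ⟨_, _, _, ⟨?_, ?_, ?_⟩, hG.root hs hfs hmaxE,
        .inr ⟨fun h => h.1 s hs hfs, card_update hfs (Nat.succ_ne_zero k)⟩⟩
      · simp [hrun, h7]
      · intro v
        have hv := v.2
        rw [hrun, if_neg (by omega), if_neg (by omega), h5, h7, Function.update_apply, h1.vertex]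
        simp [Fin.ext_iff]
      · intro e
        have he := e.2
        have hs' := s.2
        -- A root candidate has the dummy edge number `I.m`; its edge label lands in the cell just
        -- behind the last edge, which is not part of the output.
        rw [hrun, if_neg (by omega), if_neg (by omega), if_neg (by omega), h1.edge]
    · rw [hq] at hmaxE hmaxR
      refine ⟨_, _, _, ⟨?_, ?_, ?_⟩, hG.edge hl ha hb hmaxE hmaxR,
        .inr ⟨fun h => h.2 d a b hl ha hb, card_update hb ha⟩⟩
      · have := hG.le a
        rw [hrun, if_pos rfl, h7]
        omega
      · intro v
        have hv := v.2
        rw [hrun, if_neg (by omega), if_neg (by omega), h5, h7, Function.update_apply, h1.vertex]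
        simp [Fin.ext_iff]
      · intro e
        have hb' := b.2
        rw [hrun, if_neg (by omega), h6, h7, Function.update_apply]
        by_cases hed : e = d
        · subst hed; simp
        · have : (e : ℕ) ≠ d := fun h => hed (Fin.ext h)
          rw [if_neg (by omega), if_neg (by omega), if_neg hed, h1.edge]

/-- The labels that the greedy algorithm finds describe a packing of maximum weight. -/
theorem isSolution_of_grown (hG : I.graph.Grown (I.S : Set (Fin I.n)) I.w k f g)
    (hf : ∀ v, f v ≠ 0) :
    I.IsSolution (1 :: k :: ((List.finRange I.n).map f ++ (List.finRange I.m).map g)) := by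
  refine .inl ⟨k, _, _, hG.isMaxSTreePacking rfl I.edgeSet_graph hf, ⟨f, g, ?_, ?_, rfl⟩, rfl⟩
  · refine fun v => ⟨fun i hi => hi, fun h => ?_⟩
    have h1 := hG.le v
    have h2 := hf v
    refine absurd ?_ (h ⟨f v - 1, by omega⟩)
    show f v = f v - 1 + 1
    omega
  · refine fun e => ⟨fun i hi => hi.2, fun h => ?_⟩
    by_contra hg
    have h1 := hG.eq_of_isLink (I.isLink_iff.2 (.inl ⟨rfl, rfl⟩)) hg
    have h2 := hG.le (I.ends e).1
    refine h ⟨g e - 1, by omega⟩ ⟨I.edgeSet_graph ▸ Set.mem_univ e, ?_⟩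
    show g e = g e - 1 + 1
    omega

theorem output_eq {τ : Mem} (h1 : I.Holds (τ 1) k f g) (hlen : τ 1 0 = I.n + I.m + 2)
    (hone : τ 1 1 = 1) :
    output τ = 1 :: k :: ((List.finRange I.n).map f ++ (List.finRange I.m).map g) := by
  have hn : (List.finRange I.n).map f = (List.range I.n).map fun v => τ 1 (3 + v) := by
    rw [← List.map_coe_finRange_eq_range, List.map_map]
    exact List.map_congr_left fun v _ => (h1.vertex v).symm
  have hm : (List.finRange I.m).map g = (List.range I.m).map fun e => τ 1 (3 + I.n + e) := by
    rw [← List.map_coe_finRange_eq_range, List.map_map]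
    exact List.map_congr_left fun e _ => (h1.edge e).symm
  rw [output, hlen, List.range_succ_eq_map, List.range_succ_eq_map, List.range_add, hn, hm]
  simp only [List.map_cons, List.map_append, List.map_map, zero_add, hone]
  rw [← h1.count]
  congr 3
  · exact List.map_congr_left fun v _ => congrArg (τ 1) (by simp; omega)
  · exact List.map_congr_left fun v _ => congrArg (τ 1) (by simp; omega)

/-- Every round either ends stuck or labels one more vertex. After `n` rounds an unlabelled vertex
therefore certifies that the growth is stuck, hence that there is no packing. -/
theorem isSolution_output_algorithm (I : STreeInstance) :
    I.IsSolution (output (algorithm.run (input I.encode))) := by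
  obtain ⟨σ, hσ⟩ : ∃ σ, σ = (Code.count 3 1 round).run (input I.encode) := ⟨_, rfl⟩
  have hmain : σ 0 = I.inp ∧ σ 17 0 = 0 ∧ ∃ k f g, I.Holds (σ 1) k f g ∧
      I.graph.Grown (I.S : Set (Fin I.n)) I.w k f g ∧
      (I.Stuck f ∨ I.n ≤ ({v | f v ≠ 0} : Finset (Fin I.n)).card + 0) := by
    rw [hσ]
    simp only [Code.run]
    rw [show input I.encode 0 1 = I.n from rfl]
    refine countdown_induction (fun i τ => τ 0 = I.inp ∧ τ 17 0 = 0 ∧ ∃ k f g,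
      I.Holds (τ 1) k f g ∧ I.graph.Grown (I.S : Set (Fin I.n)) I.w k f g ∧
      (I.Stuck f ∨ I.n ≤ ({v | f v ≠ 0} : Finset (Fin I.n)).card + i)) ?_ ⟨rfl, rfl, ?_⟩
    · rintro i hi τ ⟨t0, t17, k, f, g, h1, hG, hP⟩
      have w0 : 0 ∉ round.writes := by
        simp [round, commit, offerRoot, offerArc, offer, block, Code.writes]
      have w17 : 17 ∉ round.writes := by
        simp [round, commit, offerRoot, offerArc, offer, block, Code.writes]
      have r0 : τ.write 3 0 i 0 = I.inp := by rw [Mem.write_of_ne (by simp), t0]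
      have r1 : τ.write 3 0 i 1 = τ 1 := Mem.write_of_ne (by simp)
      obtain ⟨k', f', g', h1', hG', hP'⟩ := run_round r0 (r1.symm ▸ h1) hG
      refine ⟨by rw [Code.run_of_notMem_writes _ w0, r0],
        by rw [Code.run_of_notMem_writes _ w17, Mem.write_of_ne (by simp), t17],
        k', f', g', h1', hG', ?_⟩
      rcases hP' with h | ⟨h, hc⟩
      · exact .inl h
      · have := hP.resolve_left h
        exact .inr (by omega)
    · exact ⟨0, 0, 0, ⟨rfl, fun _ => rfl, fun _ => rfl⟩, .start, .inr (by simp)⟩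
  obtain ⟨t0, t17, k, f, g, h1, hG, hP⟩ := hmain
  obtain ⟨ρ, hρ⟩ : ∃ ρ, ρ = (Code.count 2 1
    (.branch (label (var 2)) .skip (assign 17 (.lit 1)))).run σ := ⟨_, rfl⟩
  have hflag : ρ 0 = I.inp ∧ ρ 1 = σ 1 ∧
      (ρ 17 0 ≠ 0 ↔ ∃ v : Fin I.n, 0 ≤ (v : ℕ) ∧ f v = 0) := by
    rw [hρ]
    simp only [Code.run]
    rw [show σ 0 1 = I.n by rw [t0, inp_one]]
    refine countdown_induction (fun i τ => τ 0 = I.inp ∧ τ 1 = σ 1 ∧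
      (τ 17 0 ≠ 0 ↔ ∃ v : Fin I.n, i ≤ (v : ℕ) ∧ f v = 0)) ?_ ⟨?_, ?_, ?_⟩
    · rintro i hi τ ⟨t0, t1, t17⟩
      have hl : (label (var 2)).eval (τ.write 2 0 i) = f ⟨i, hi⟩ := by
        rw [← h1.vertex]
        simp [label, Expr.eval, Mem.write_apply, t1]
      have hsplit : (∃ v : Fin I.n, i ≤ (v : ℕ) ∧ f v = 0) ↔
          f ⟨i, hi⟩ = 0 ∨ ∃ v : Fin I.n, i + 1 ≤ (v : ℕ) ∧ f v = 0 := by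
        constructor
        · rintro ⟨v, hv, hfv⟩
          rcases hv.eq_or_lt with h | h
          · obtain rfl : ⟨i, hi⟩ = v := Fin.ext h
            exact .inl hfv
          · exact .inr ⟨v, h, hfv⟩
        · rintro (h | ⟨v, hv, hfv⟩)
          · exact ⟨_, le_rfl, h⟩
          · exact ⟨v, by omega, hfv⟩
      rw [hl, hsplit, ← t17]
      split_ifs with h
      · simp [Mem.write_apply, Mem.write_of_ne, t0, t1, h]
      · simp [Mem.write_apply, Mem.write_of_ne, t0, t1, Expr.eval, not_not.1 h]
    · rw [Mem.write_of_ne (by simp), t0]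
    · rw [Mem.write_of_ne (by simp)]
    · rw [Mem.write_of_ne (by simp), t17]
      simp only [ne_eq, not_true, false_iff]
      rintro ⟨v, hv, -⟩
      omega
  obtain ⟨r0, r1, r17⟩ := hflag
  rw [← r1] at h1
  have hrun : algorithm.run (input I.encode) =
      if ρ 17 0 ≠ 0 then (ρ.write 1 0 1).write 1 1 0
      else (ρ.write 1 0 (I.n + I.m + 2)).write 1 1 1 := by
    have : algorithm.run (input I.encode) = if ρ 17 0 ≠ 0 then (ρ.write 1 0 1).write 1 1 0
      else (ρ.write 1 0 (ρ 0 1 + ρ 0 2 + 2)).write 1 1 1 := by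
      rw [hρ, hσ]
      rfl
    rw [this, r0, inp_one, inp_two]
  rw [hrun]
  split_ifs with h
  · refine .inr ⟨?_, by simp [output, Mem.write_apply]⟩
    obtain ⟨v, -, hv⟩ := r17.1 h
    have hst : I.Stuck f := by
      refine hP.resolve_right fun hc => ?_
      have : ({v | f v ≠ 0} : Finset (Fin I.n)) = Finset.univ :=
        Finset.eq_univ_of_card _ (le_antisymm (Finset.card_le_univ _) (by simpa using hc))
      have hm := this ▸ Finset.mem_univ v
      exact (Finset.mem_filter.1 hm).2 hv
    exact Graph.not_exists_isSTreePacking rfl hv (fun s hs => hst.1 s hs) hst.2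
  · have hf : ∀ v, f v ≠ 0 := fun v hv => h (r17.2 ⟨v, by simp, hv⟩)
    rw [output_eq (I := I) (k := k) (f := f) (g := g) ⟨?_, ?_, ?_⟩ ?_ ?_]
    · exact isSolution_of_grown hG hf
    · simp [Mem.write_apply, h1.count]
    · intro v
      simp [Mem.write_apply, ← h1.vertex]
      omega
    · intro e
      simp [Mem.write_apply, ← h1.edge]
      omega
    · simp [Mem.write_apply]
    · simp [Mem.write_apply]

end STreeInstance

theorem mainTheorem10 :
    RAM.SolvableInPolyTime STreeInstance.encode STreeInstance.IsSolution := by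
  refine .of_code STreeInstance.algorithm STreeInstance.wf_algorithm ?_ ?_
    STreeInstance.isSolution_output_algorithm
  -- The loop bounds must be small as numbers, not only in bits. They are, since the encoding has at
  -- least one entry per vertex and per edge.
  · intro I
    have := RAM.length_le_bitSize I.encode
    rw [I.length_encode] at this
    exact I.inp_one.trans_le (by omega)
  · intro I
    have := RAM.length_le_bitSize I.encode
    rw [I.length_encode] at this
    exact I.inp_two.trans_le (by omega)
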